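/- An iterated action of a collection of groups $\mathcal G=\{G_1,\dots,G_n\}$ on a topological space $X$ (written $\mathcal G\curvearrowright X$) consists of topological spaces and surjections $X=X_0\xrightarrow{p_1}X_1\xrightarrow{p_2}\cdots\xrightarrow{p_n}X_n$ and group actions $\Phi_i:G_i\to\operatorname{Homeo}(X_{i-1})$ such that $p_i$ is the orbit map of the action of $G_i$ on $X_{i-1}$ (so $X_i$ carries the quotient topology); the empty collection, $n=0$, is allowed. It is free if all the actions $\Phi_i$ are free. Two free iterated actions $\mathcal G\curvearrowright X$ and $\mathcal G'\curvearrowright X$ of finite groups, with $p=p_n\circ\cdots\circ p_1$ and $p'=p'_{n'}\circ\cdots\circ p'_1$, are equivalent if there are homeomorphisms $f:X_n\to X'_{n'}$ and $\overline f:X\to X$ with $p'\circ\overline f=f\circ p$. The length $l(\mathcal G\curvearrowright X)$ is the least number of groups in a free iterated action of finite groups on $X$ that is equivalent to $\mathcal G\curvearrowright X$, and the iterated length $l(X)\in\mathbb N\cup\{\infty\}$ is the supremum of $l(\mathcal G\curvearrowright X)$ over all free iterated actions of finite groups on $X$. Let $M$ be a closed topological manifold (compact, Hausdorff, without boundary,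 of some dimension $d\ge 0$, not necessarily connected) with Euler characteristic $\chi(M)=\sum_i(-1)^i\dim_{\mathbb Q}H_i(M;\mathbb Q)\neq 0$. Then $l(M)$ is finite and $$l(M)\le \log_2|\chi(M)|.$$ -/

import Mathlib

universe u

/-- An iterated action on the space `X`: a finite sequence (possibly of length `0`) of surjections
`X = X₀ → X₁ → ⋯ → Xₙ` and of group actions `Φᵢ : Gᵢ → Homeo(Xᵢ₋₁)` such that `Xᵢ₋₁ → Xᵢ` is the
orbit map of the action `Φᵢ`. The value `nil` is the empty sequence and `cons` prepends the
step `X = X₀ → X₁` to an iterated action on `X₁`. -/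
inductive IteratedAction : (X : Type u) → [TopologicalSpace X] → Type (u + 1)
  | nil {X : Type u} [TopologicalSpace X] : IteratedAction X
  | cons {X X₁ : Type u} [TopologicalSpace X] [TopologicalSpace X₁]
      (G : Type u) [Group G] (Φ : G →* (X ≃ₜ X)) (p : X → X₁)
      (quotient : Topology.IsQuotientMap p)
      (orbit : ∀ x y : X, p x = p y ↔ ∃ g : G, Φ g x = y)
      (tail : IteratedAction X₁) : IteratedAction X

namespace IteratedAction

/-- The number `n` of groups `G₁, …, Gₙ`. -/
def numGroups : {X : Type u} → [TopologicalSpace X] → IteratedAction X → ℕ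
  | _, _, nil => 0
  | _, _, cons _ _ _ _ _ tail => tail.numGroups + 1

/-- The last space `Xₙ` of the sequence. -/
def lastSpace : {X : Type u} → [TopologicalSpace X] → IteratedAction X → TopCat.{u}
  | X, _, nil => TopCat.of X
  | _, _, cons _ _ _ _ _ tail => tail.lastSpace

/-- The composition `p = pₙ ∘ ⋯ ∘ p₁ : X → Xₙ`. -/
def proj : {X : Type u} → [TopologicalSpace X] → (A : IteratedAction X) → X → A.lastSpace
  | _, _, nil => fun x => x
  | _, _, cons _ _ p _ _ tail => fun x => tail.proj (p x)

/-- All the groups `Gᵢ` are finite. -/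
def FiniteGroups : {X : Type u} → [TopologicalSpace X] → IteratedAction X → Prop
  | _, _, nil => True
  | _, _, cons G _ _ _ _ tail => Finite G ∧ tail.FiniteGroups

/-- All the actions `Φᵢ` are free. -/
def IsFree : {X : Type u} → [TopologicalSpace X] → IteratedAction X → Prop
  | _, _, nil => True
  | _, _, cons _ Φ _ _ _ tail => (∀ g x, Φ g x = x → g = 1) ∧ tail.IsFree

variable {X : Type u} [TopologicalSpace X]

/-- `A` and `B` are equivalent: there are homeomorphisms `f : Xₙ → X'ₙ'` and `f' : X → X` with
`p' ∘ f' = f ∘ p`. -/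
def Equivalent (A B : IteratedAction X) : Prop :=
  ∃ (f : A.lastSpace ≃ₜ B.lastSpace) (f' : X ≃ₜ X), ∀ x, B.proj (f' x) = f (A.proj x)

/-- The length of `A`: the least number of groups of a free iterated action of finite groups on `X`
that is equivalent to `A`. -/
noncomputable def length (A : IteratedAction X) : ℕ :=
  sInf {n | ∃ B : IteratedAction X,
    B.FiniteGroups ∧ B.IsFree ∧ A.Equivalent B ∧ B.numGroups = n}

end IteratedAction

/-- The iterated length of `X`: the supremum, possibly `∞`, of the lengths of all the free iterated
actions of finite groups on `X`. -/
noncomputable def iteratedLength (X : Type u) [TopologicalSpace X] : ℕ∞ :=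
  ⨆ (A : IteratedAction X) (_ : A.FiniteGroups) (_ : A.IsFree), (A.length : ℕ∞)

/-- The Euler characteristic `∑ᵢ (-1)ⁱ dim Hᵢ(X; ℚ)`, with singular homology. -/
noncomputable def eulerCharacteristic (X : Type u) [TopologicalSpace X] : ℤ :=
  (((AlgebraicTopology.singularChainComplexFunctor (ModuleCat.{u} ℚ)).obj
    (ModuleCat.of ℚ (ULift.{u} ℚ))).obj (TopCat.of X)).homologyEulerChar

/-!
The bound follows from the multiplicativity of the Euler characteristic
(`eulerCharacteristic_eq_card_mul`): if a finite group `G` acts freely on a compact Hausdorff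
locally Euclidean space `X`, then `χ(X) = |G| χ(X/G)`. The orbit space `X/G` is again compact,
Hausdorff and locally Euclidean, so that this applies to each step of an iterated action. A step
with a trivial group is a homeomorphism and can be dropped, which yields an
equivalent iterated action, and every other step divides the nonzero integer `χ` by at least `2`
(`IteratedAction.exists_two_pow_numGroups_le`).

A topological manifold need not have a triangulation, hence multiplicativity is proved from two
facts about singular homology.
* The transfer of the covering `X → X/G` shows that `|G| dim Hₙ(X/G)` is the sum of the traces of
  the elements of `G` on `Hₙ(X)` (`card_mul_finrank_H`).
* The Lefschetz number of a map `X → X` without fixed points vanishes; in terms of reduced homology,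
  its alternating trace is `-1` (`FiniteModel.sum_trace_eq_neg_one`).

For the second fact, `X` is embedded isometrically into a Banach space, where it is a retract of a
neighborhood (`exists_nhds_retraction`). Given a fine finite net of points of `X`, let `L` be the
finite simplicial complex whose simplices are the sets of pairwise close points of the net. Small
singular simplices of `X` are approximated by simplices of `L`, and simplices of `L` are mapped to
`X` by affine simplices followed by the retraction. By the method of acyclic carriers, this exhibits
the small singular chains of `X` as a homotopy retract of the chains of `L`
(`exists_finiteModel`), and small chains compute singular homology by barycentric subdivision
(`smallIncl_onH_bijective`). In particular the homology of `X` is finite-dimensional and vanishes in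
large degrees. If a map moves all points of `X` further than the mesh of the net, then the induced
map of the chains of `L` moves each simplex off itself, and the Hopf trace formula applies
(`Cx.sum_trace_onH_eq_neg_one`).

Chain complexes are augmented and indexed by the number of vertices: the empty simplex is the only
one at index `0`, so that chain maps and homotopies can be constructed by induction from the empty
simplex, and the resulting homology is reduced. `eulerCharacteristic_eq` relates it to the
Euler characteristic.
-/

universe v w

/-! ### Rational chain complexes, homology and traces -/

/-- A chain complex of rational vector spaces. The indexing is that of augmented complexes: the
index `n` stands for the geometric dimension `n - 1`. -/
structure Cx where
  X : ℕ → Type u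
  [acg : ∀ n, AddCommGroup (X n)]
  [mod : ∀ n, Module ℚ (X n)]
  d : ∀ n, X (n + 1) →ₗ[ℚ] X n
  d_d : ∀ n x, d n (d (n + 1) x) = 0

namespace Cx

attribute [instance] Cx.acg Cx.mod

/-- Homology in geometric dimension `n`, that is, at index `n + 1`. -/
abbrev H (C : Cx.{u}) (n : ℕ) : Type u :=
  LinearMap.ker (C.d n) ⧸ (LinearMap.range (C.d (n + 1))).submoduleOf (LinearMap.ker (C.d n))

/-- The homology class of a cycle. -/
def cls (C : Cx.{u}) (n : ℕ) : LinearMap.ker (C.d n) →ₗ[ℚ] C.H n :=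
  Submodule.mkQ _

lemma cls_surjective (C : Cx.{u}) (n : ℕ) : Function.Surjective (C.cls n) :=
  Submodule.mkQ_surjective _

lemma cls_eq_zero_iff (C : Cx.{u}) (n : ℕ) (z : LinearMap.ker (C.d n)) :
    C.cls n z = 0 ↔ ∃ b, C.d (n + 1) b = z :=
  Submodule.Quotient.mk_eq_zero _

/-- A chain map. -/
structure Hom (C : Cx.{u}) (D : Cx.{v}) where
  f : ∀ n, C.X n →ₗ[ℚ] D.X n
  comm : ∀ n x, D.d n (f (n + 1) x) = f n (C.d n x)

namespace Hom

/-- The identity chain map. -/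
def id (C : Cx.{u}) : Hom C C := ⟨fun _ => LinearMap.id, fun _ _ => rfl⟩

/-- Composition of chain maps, in the order of functions. -/
def comp {C : Cx.{u}} {D : Cx.{v}} {E : Cx.{w}} (g : Hom D E) (f : Hom C D) : Hom C E :=
  ⟨fun n => g.f n ∘ₗ f.f n, fun n x => by simp [g.comm, f.comm]⟩

variable {C : Cx.{u}} {D : Cx.{v}} {E : Cx.{w}}

/-- The induced map on cycles. -/
def onKer (f : Hom C D) (n : ℕ) : LinearMap.ker (C.d n) →ₗ[ℚ] LinearMap.ker (D.d n) :=
  (f.f (n + 1)).restrict fun x hx => by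
    simp only [LinearMap.mem_ker] at hx ⊢
    rw [f.comm, hx, map_zero]

@[simp] lemma onKer_coe (f : Hom C D) (n : ℕ) (z : LinearMap.ker (C.d n)) :
    (f.onKer n z : D.X (n + 1)) = f.f (n + 1) z := rfl

/-- The induced map on homology. -/
def onH (f : Hom C D) (n : ℕ) : C.H n →ₗ[ℚ] D.H n :=
  Submodule.mapQ _ _ (f.onKer n) <| by
    rintro ⟨z, hz⟩ ⟨b, hb⟩
    refine ⟨f.f (n + 2) b, ?_⟩
    rw [f.comm, hb]
    rfl

@[simp] lemma onH_cls (f : Hom C D) (n : ℕ) (z : LinearMap.ker (C.d n)) :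
    f.onH n (C.cls n z) = D.cls n (f.onKer n z) := rfl

lemma onH_id (n : ℕ) : (id C).onH n = LinearMap.id := by
  refine LinearMap.ext fun x => ?_
  obtain ⟨z, rfl⟩ := C.cls_surjective n x
  rfl

lemma onH_comp (g : Hom D E) (f : Hom C D) (n : ℕ) :
    (g.comp f).onH n = g.onH n ∘ₗ f.onH n := by
  refine LinearMap.ext fun x => ?_
  obtain ⟨z, rfl⟩ := C.cls_surjective n x
  rfl

/-- Chain homotopic maps agree on homology. -/
lemma onH_eq_of_homotopy (f g : Hom C D) (h : ∀ n, C.X n →ₗ[ℚ] D.X (n + 1))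
    (hh : ∀ n x, f.f (n + 1) x - g.f (n + 1) x = D.d (n + 1) (h (n + 1) x) + h n (C.d n x))
    (n : ℕ) : f.onH n = g.onH n := by
  refine LinearMap.ext fun x => ?_
  obtain ⟨z, rfl⟩ := C.cls_surjective n x
  rw [onH_cls, onH_cls, ← sub_eq_zero, ← map_sub, cls_eq_zero_iff]
  refine ⟨h (n + 1) z, ?_⟩
  have := hh n z
  rw [LinearMap.mem_ker.1 z.2, map_zero, add_zero] at this
  rw [← this]
  rfl

end Hom

end Cx

section Trace

variable {A B C : Type*} [AddCommGroup A] [Module ℚ A] [AddCommGroup B] [Module ℚ B]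
  [AddCommGroup C] [Module ℚ C]

/-- The trace is additive on short exact sequences. -/
lemma trace_eq_add_of_exact [FiniteDimensional ℚ B] (i : A →ₗ[ℚ] B) (p : B →ₗ[ℚ] C)
    (hi : Function.Injective i) (hp : Function.Surjective p) (hip : Function.Exact i p)
    (a : A →ₗ[ℚ] A) (b : B →ₗ[ℚ] B) (c : C →ₗ[ℚ] C)
    (hab : ∀ x, i (a x) = b (i x)) (hbc : ∀ x, p (b x) = c (p x)) :
    LinearMap.trace ℚ B b = LinearMap.trace ℚ A a + LinearMap.trace ℚ C c := by
  have : FiniteDimensional ℚ A := FiniteDimensional.of_injective i hi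
  have : FiniteDimensional ℚ C := Module.Finite.of_surjective p hp
  obtain ⟨s, hs⟩ := p.exists_rightInverse_of_surjective (LinearMap.range_eq_top.2 hp)
  obtain ⟨r, hr⟩ := i.exists_leftInverse_of_injective (LinearMap.ker_eq_bot.2 hi)
  have hs' : ∀ x, p (s x) = x := fun x => congr($hs x)
  have hr' : ∀ x, r (i x) = x := fun x => congr($hr x)
  have key : ∀ x, i (r (x - s (p x))) = x - s (p x) := by
    intro x
    obtain ⟨y, hy⟩ := (hip (x - s (p x))).1 (by simp [hs'])
    rw [← hy, hr']
  -- `q` is the retraction of `i` that vanishes on the image of `s`, so that `1 = i q + s p`.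
  set q : B →ₗ[ℚ] A := r ∘ₗ (LinearMap.id - s ∘ₗ p) with hq
  have hb : b = (b ∘ₗ i) ∘ₗ q + (b ∘ₗ s) ∘ₗ p := by
    ext x
    have := key x
    simp only [hq, LinearMap.add_apply, LinearMap.comp_apply, LinearMap.sub_apply,
      LinearMap.id_apply]
    rw [this]
    simp
  have ha : q ∘ₗ (b ∘ₗ i) = a := by
    ext x
    simp only [hq, LinearMap.comp_apply, LinearMap.sub_apply, LinearMap.id_apply, ← hab]
    rw [(hip _).2 ⟨_, rfl⟩]
    simp [hr']
  have hc : p ∘ₗ (b ∘ₗ s) = c := by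
    ext x
    simp [hbc, hs']
  rw [hb, map_add, LinearMap.trace_comp_comm' q (b ∘ₗ i), LinearMap.trace_comp_comm' p (b ∘ₗ s),
    ha, hc]

lemma exact_subtype_rangeRestrict (f : A →ₗ[ℚ] B) :
    Function.Exact (LinearMap.ker f).subtype f.rangeRestrict := by
  intro x
  simp [Subtype.ext_iff]

end Trace

namespace Cx

variable {C : Cx.{u}}

/-- The induced map on boundaries. -/
def Hom.onRange (φ : Hom C C) (n : ℕ) : LinearMap.range (C.d n) →ₗ[ℚ] LinearMap.range (C.d n) :=
  (φ.f n).restrict <| by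
    rintro _ ⟨y, rfl⟩
    exact ⟨φ.f (n + 1) y, φ.comm n y⟩

/-- The trace on chains is the sum of the traces on homology and on the two adjacent groups of
boundaries. -/
lemma trace_eq_trace_onH_add (φ : Hom C C) (n : ℕ) [FiniteDimensional ℚ (C.X (n + 1))] :
    LinearMap.trace ℚ _ (φ.f (n + 1)) = LinearMap.trace ℚ _ (φ.onH n)
      + LinearMap.trace ℚ _ (φ.onRange n) + LinearMap.trace ℚ _ (φ.onRange (n + 1)) := by
  have hle : LinearMap.range (C.d (n + 1)) ≤ LinearMap.ker (C.d n) := by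
    rintro _ ⟨y, rfl⟩
    exact C.d_d n y
  rw [trace_eq_add_of_exact (LinearMap.ker (C.d n)).subtype (C.d n).rangeRestrict
    (Submodule.subtype_injective _) (LinearMap.surjective_rangeRestrict _)
    (exact_subtype_rangeRestrict _) (φ.onKer n) (φ.f (n + 1)) (φ.onRange n)
    (fun _ => rfl) (fun x => Subtype.ext (φ.comm n x)),
    trace_eq_add_of_exact (Submodule.inclusion hle) (C.cls n)
    (Submodule.inclusion_injective _) (C.cls_surjective n) ?_ (φ.onRange (n + 1)) (φ.onKer n)
    (φ.onH n) (fun _ => rfl) (fun _ => rfl)]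
  · ring
  · intro z
    rw [cls_eq_zero_iff]
    constructor
    · rintro ⟨b, hb⟩
      exact ⟨⟨z, b, hb⟩, rfl⟩
    · rintro ⟨⟨_, b, rfl⟩, rfl⟩
      exact ⟨b, rfl⟩

/-- The Hopf trace formula for the reduced homology of a bounded complex. -/
lemma hopf_trace (φ : Hom C C) [∀ n, FiniteDimensional ℚ (C.X n)] (N : ℕ) :
    ∑ n ∈ Finset.range N, (-1 : ℚ) ^ n * LinearMap.trace ℚ _ (φ.f (n + 1)) =
      ∑ n ∈ Finset.range N, (-1 : ℚ) ^ n * LinearMap.trace ℚ _ (φ.onH n)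
        + LinearMap.trace ℚ _ (φ.onRange 0)
        - (-1 : ℚ) ^ N * LinearMap.trace ℚ _ (φ.onRange N) := by
  induction N with
  | zero => simp
  | succ N ih =>
    rw [Finset.sum_range_succ, Finset.sum_range_succ, ih, trace_eq_trace_onH_add]
    ring

/-- If a self-map of a bounded complex has no fixed part in nonnegative dimensions, then its
alternating trace on reduced homology is `-1`. -/
lemma sum_trace_onH_eq_neg_one (φ : Hom C C) [∀ n, FiniteDimensional ℚ (C.X n)] (N : ℕ)
    (hN : Subsingleton (C.X N)) (h0 : φ.f 0 = LinearMap.id) (h1 : Module.finrank ℚ (C.X 0) = 1)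
    (hd : Function.Surjective (C.d 0)) (htr : ∀ n, LinearMap.trace ℚ _ (φ.f (n + 1)) = 0) :
    ∑ n ∈ Finset.range N, (-1 : ℚ) ^ n * LinearMap.trace ℚ _ (φ.onH n) = -1 := by
  have h := hopf_trace φ N
  have hB0 : LinearMap.trace ℚ _ (φ.onRange 0) = 1 := by
    have : φ.onRange 0 = LinearMap.id := by
      ext x
      simp [Hom.onRange, h0]
    rw [this, LinearMap.trace_id, LinearMap.range_eq_top.2 hd, finrank_top, h1, Nat.cast_one]
  have hBN : LinearMap.trace ℚ _ (φ.onRange N) = 0 := by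
    have : φ.onRange N = 0 := by
      ext x
      exact Subsingleton.elim _ _
    rw [this, map_zero]
  simp only [htr, mul_zero, Finset.sum_const_zero, hB0, hBN] at h
  linarith

end Cx

/-! ### Semisimplicial sets and acyclic carriers -/

section Finsupp

variable {α : Type*} {M : Type*} [AddCommGroup M] [Module ℚ M]

lemma finsupp_hom_ext {f g : (α →₀ ℚ) →ₗ[ℚ] M}
    (h : ∀ x, f (Finsupp.single x 1) = g (Finsupp.single x 1)) : f = g :=
  Finsupp.lhom_ext' fun x => LinearMap.ext_ring (h x)

lemma finsupp_map_mem {A : Set α} {W : Submodule ℚ M} (f : (α →₀ ℚ) →ₗ[ℚ] M)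
    (h : ∀ x ∈ A, f (Finsupp.single x 1) ∈ W) {c : α →₀ ℚ}
    (hc : c ∈ Finsupp.supported ℚ ℚ A) : f c ∈ W := by
  rw [Finsupp.supported_eq_span_single] at hc
  have : Submodule.span ℚ ((fun i => Finsupp.single i (1 : ℚ)) '' A) ≤ W.comap f := by
    rw [Submodule.span_le]
    rintro _ ⟨x, hx, rfl⟩
    exact h x hx
  exact this hc

lemma finsupp_map_eq {A : Set α} (f g : (α →₀ ℚ) →ₗ[ℚ] M)
    (h : ∀ x ∈ A, f (Finsupp.single x 1) = g (Finsupp.single x 1)) {c : α →₀ ℚ}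
    (hc : c ∈ Finsupp.supported ℚ ℚ A) : f c = g c := by
  have : (f - g) c ∈ (⊥ : Submodule ℚ M) :=
    finsupp_map_mem (f - g) (fun x hx => by simp [h x hx]) hc
  simpa [sub_eq_zero] using this

end Finsupp

/-- An augmented semisimplicial set: `S n` is the set of simplices with `n` vertices (so that `S 0`
consists of the empty simplices), and `face i` omits the vertex `i`. -/
structure SemiSet where
  S : ℕ → Type u
  face : ∀ {n}, Fin (n + 1) → S (n + 1) → S n
  face_face : ∀ {n} (i : Fin (n + 2)) (j : Fin (n + 1)) (x : S (n + 2)),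
    face (j.predAbove i) (face (i.succAbove j) x) = face j (face i x)

namespace SemiSet

/-- The rational simplicial chains with `n` vertices. -/
abbrev Chains (K : SemiSet.{u}) (n : ℕ) : Type u := K.S n →₀ ℚ

/-- The simplex `x` as a chain. -/
noncomputable abbrev of (K : SemiSet.{u}) {n : ℕ} (x : K.S n) : K.Chains n := Finsupp.single x 1

/-- The boundary operator. -/
noncomputable def bd (K : SemiSet.{u}) (n : ℕ) : K.Chains (n + 1) →ₗ[ℚ] K.Chains n :=
  Finsupp.linearCombination ℚ fun x => ∑ i : Fin (n + 1), (-1 : ℚ) ^ (i : ℕ) • K.of (K.face i x)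

lemma bd_of (K : SemiSet.{u}) {n : ℕ} (x : K.S (n + 1)) :
    K.bd n (K.of x) = ∑ i : Fin (n + 1), (-1 : ℚ) ^ (i : ℕ) • K.of (K.face i x) := by
  simp [bd]

lemma bd_bd (K : SemiSet.{u}) (n : ℕ) (c : K.Chains (n + 2)) : K.bd n (K.bd (n + 1) c) = 0 := by
  suffices h : K.bd n ∘ₗ K.bd (n + 1) = 0 from congr($h c)
  refine finsupp_hom_ext fun x => ?_
  simp only [LinearMap.comp_apply, bd_of, map_sum, map_smul, Finset.smul_sum, smul_smul,
    LinearMap.zero_apply, ← Finset.sum_product', Finset.univ_product_univ]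
  -- The terms cancel in pairs: omitting the vertices `i`, `i.succAbove j` in either order.
  refine Finset.sum_involution (fun p _ => (p.1.succAbove p.2, p.2.predAbove p.1)) ?_ ?_ ?_ ?_
  · rintro ⟨i, j⟩ -
    have h : (-1 : ℚ) ^ ((i.succAbove j : ℕ) + (j.predAbove i : ℕ))
        = - (-1) ^ ((i : ℕ) + (j : ℕ)) := by
      rcases Nat.even_or_odd ((i : ℕ) + j) with h | h
      · rw [h.neg_one_pow, Odd.neg_one_pow]
        rw [← Nat.not_even_iff_odd, Fin.even_succAbove_add_predAbove, Nat.not_odd_iff_even]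
        exact h
      · rw [h.neg_one_pow, Even.neg_one_pow ((Fin.even_succAbove_add_predAbove i j).2 h), neg_neg]
    simp only [← pow_add, K.face_face, h]
    module
  · rintro ⟨i, j⟩ - - h
    exact Fin.succAbove_ne i j congr($h.1)
  · simp
  · rintro ⟨i, j⟩ -
    simp [Fin.succAbove_succAbove_predAbove, Fin.predAbove_predAbove_succAbove]

/-- The augmented rational chain complex. -/
noncomputable abbrev cx (K : SemiSet.{u}) : Cx.{u} where
  X n := K.Chains n
  d := K.bd
  d_d := K.bd_bd

/-- A semisimplicial map. -/
structure Map (K : SemiSet.{u}) (L : SemiSet.{v}) where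
  app : ∀ n, K.S n → L.S n
  face : ∀ {n} (i : Fin (n + 1)) (x : K.S (n + 1)), app n (K.face i x) = L.face i (app (n + 1) x)

variable {K : SemiSet.{u}} {L : SemiSet.{v}}

/-- The linear map on chains induced by a semisimplicial map. -/
noncomputable def Map.lin (φ : Map K L) (n : ℕ) : K.Chains n →ₗ[ℚ] L.Chains n :=
  Finsupp.lmapDomain ℚ ℚ (φ.app n)

lemma Map.lin_of (φ : Map K L) {n : ℕ} (x : K.S n) : φ.lin n (K.of x) = L.of (φ.app n x) := by
  simp [lin, Finsupp.mapDomain_single]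

lemma Map.bd_lin (φ : Map K L) (n : ℕ) (c : K.Chains (n + 1)) :
    L.bd n (φ.lin (n + 1) c) = φ.lin n (K.bd n c) := by
  suffices h : L.bd n ∘ₗ φ.lin (n + 1) = φ.lin n ∘ₗ K.bd n from congr($h c)
  refine finsupp_hom_ext fun x => ?_
  simp only [LinearMap.comp_apply, lin_of, bd_of, φ.face, map_sum, map_smul]

/-- The chain map induced by a semisimplicial map. -/
@[simps]
noncomputable def Map.hom (φ : Map K L) : Cx.Hom K.cx L.cx where
  f := φ.lin
  comm := φ.bd_lin

/-- The subcomplex of the simplices with a property that is inherited by faces. -/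
abbrev sub (K : SemiSet.{u}) (P : ∀ n, K.S n → Prop)
    (hP : ∀ n (i : Fin (n + 1)) (x : K.S (n + 1)), P (n + 1) x → P n (K.face i x)) :
    SemiSet.{u} where
  S n := {x : K.S n // P n x}
  face i x := ⟨K.face i x.1, hP _ i x.1 x.2⟩
  face_face i j x := Subtype.ext (K.face_face i j x.1)

section Sub

variable {P : ∀ n, K.S n → Prop}
  {hP : ∀ n (i : Fin (n + 1)) (x : K.S (n + 1)), P (n + 1) x → P n (K.face i x)}

variable (K P hP) in
/-- The inclusion of a subcomplex. -/
def subMap : Map (K.sub P hP) K where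
  app _ x := x.1
  face _ _ := rfl

variable (K P) in
/-- The chains supported in a subcomplex. -/
noncomputable abbrev subChains (n : ℕ) : Submodule ℚ (K.Chains n) :=
  Finsupp.supported ℚ ℚ {x | P n x}

variable (K P hP) in
/-- Restriction of a chain to a subcomplex: the simplices outside the subcomplex are dropped. -/
noncomputable def res (n : ℕ) : K.Chains n →ₗ[ℚ] (K.sub P hP).Chains n :=
  Finsupp.lsubtypeDomain {x | P n x}

lemma res_of {n : ℕ} (x : K.S n) (hx : P n x) :
    K.res P hP n (K.of x) = (K.sub P hP).of ⟨x, hx⟩ := by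
  classical
  ext y
  change Finsupp.single x (1 : ℚ) y.1 = _
  simp only [Finsupp.single_apply, Subtype.ext_iff]

lemma subMap_res {n : ℕ} {c : K.Chains n} (hc : c ∈ K.subChains P n) :
    (K.subMap P hP).lin n (K.res P hP n c) = c := by
  refine finsupp_map_eq ((K.subMap P hP).lin n ∘ₗ K.res P hP n) LinearMap.id ?_ hc
  intro x hx
  rw [LinearMap.comp_apply, res_of x hx, Map.lin_of]
  rfl

lemma res_subMap {n : ℕ} (c : (K.sub P hP).Chains n) :
    K.res P hP n ((K.subMap P hP).lin n c) = c := by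
  suffices h : K.res P hP n ∘ₗ (K.subMap P hP).lin n = LinearMap.id from congr($h c)
  refine finsupp_hom_ext fun x => ?_
  rw [LinearMap.comp_apply, Map.lin_of]
  exact res_of x.1 x.2

lemma subMap_mem {n : ℕ} (c : (K.sub P hP).Chains n) :
    (K.subMap P hP).lin n c ∈ K.subChains P n := by
  refine finsupp_map_mem (A := Set.univ) _ (fun x _ => ?_) (by simp)
  rw [Map.lin_of]
  exact Finsupp.single_mem_supported _ _ x.2

lemma bd_res {n : ℕ} {c : K.Chains (n + 1)} (hc : c ∈ K.subChains P (n + 1)) :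
    (K.sub P hP).bd n (K.res P hP (n + 1) c) = K.res P hP n (K.bd n c) := by
  conv_rhs => rw [← subMap_res (hP := hP) hc, Map.bd_lin, res_subMap]

variable (hP) in
/-- A chain map with values in a subcomplex, as a chain map to the subcomplex. -/
noncomputable def lift {C : Cx.{w}} (φ : Cx.Hom C K.cx)
    (h : ∀ n x, φ.f n x ∈ K.subChains P n) : Cx.Hom C (K.sub P hP).cx where
  f n := K.res P hP n ∘ₗ φ.f n
  comm n x := by
    rw [LinearMap.comp_apply, LinearMap.comp_apply, ← φ.comm]
    exact bd_res (h (n + 1) x)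

end Sub

section Carriers

/-- Carriers for maps from the chains of `K` to the complex `D`: to each simplex `x` a family `A x`
of chains of `D`, monotone in `x`, and for each nonempty simplex a contraction of `A x`. These data
determine chain maps (`Carrier.extend`) and chain homotopies (`Carrier.homotopyFun`) by induction
on the number of vertices. -/
structure Carrier (K : SemiSet.{u}) (D : Cx.{v}) where
  A : ∀ {n}, K.S n → ∀ k, Submodule ℚ (D.X k)
  mono : ∀ {n} (i : Fin (n + 1)) (x : K.S (n + 1)) k, A (K.face i x) k ≤ A x k
  cone : ∀ {n}, K.S (n + 1) → ∀ k, D.X k →ₗ[ℚ] D.X (k + 1)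
  cone_mem : ∀ {n} (x : K.S (n + 1)) k, ∀ c ∈ A x k, cone x k c ∈ A x (k + 1)
  d_cone : ∀ {n} (x : K.S (n + 1)) k, ∀ c ∈ A x (k + 1),
    D.d (k + 1) (cone x (k + 1) c) = c - cone x k (D.d k c)
  d_cone_zero : ∀ {n} (x : K.S (n + 1)), ∀ c ∈ A x 0, D.d 0 (cone x 0 c) = c

namespace Carrier

variable {D : Cx.{v}} (𝒜 : Carrier K D)

lemma map_bd_mem {s n : ℕ} {f : K.Chains n →ₗ[ℚ] D.X s} (hf : ∀ x, f (K.of x) ∈ 𝒜.A x s)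
    (x : K.S (n + 1)) : f (K.bd n (K.of x)) ∈ 𝒜.A x s := by
  rw [bd_of, map_sum]
  refine Submodule.sum_mem _ fun i _ => ?_
  rw [map_smul]
  exact Submodule.smul_mem _ _ (𝒜.mono i x _ (hf _))

/-- The chain map that extends `f₀` and is given on simplices by coning off the boundary. -/
noncomputable def extendFun (f₀ : K.Chains 0 →ₗ[ℚ] D.X 0) : ∀ n, K.Chains n →ₗ[ℚ] D.X n
  | 0 => f₀
  | n + 1 => Finsupp.linearCombination ℚ fun x => 𝒜.cone x n (extendFun f₀ n (K.bd n (K.of x)))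

lemma extendFun_of (f₀ : K.Chains 0 →ₗ[ℚ] D.X 0) {n : ℕ} (x : K.S (n + 1)) :
    𝒜.extendFun f₀ (n + 1) (K.of x) = 𝒜.cone x n (𝒜.extendFun f₀ n (K.bd n (K.of x))) := by
  rw [extendFun]
  simp

variable {f₀ : K.Chains 0 →ₗ[ℚ] D.X 0}

lemma extendFun_mem (h₀ : ∀ x, f₀ (K.of x) ∈ 𝒜.A x 0) (n : ℕ) (x : K.S n) :
    𝒜.extendFun f₀ n (K.of x) ∈ 𝒜.A x n := by
  induction n with
  | zero => exact h₀ x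
  | succ n ih =>
    rw [extendFun_of]
    exact 𝒜.cone_mem x n _ (𝒜.map_bd_mem ih x)

lemma d_extendFun (h₀ : ∀ x, f₀ (K.of x) ∈ 𝒜.A x 0) (n : ℕ) (c : K.Chains (n + 1)) :
    D.d n (𝒜.extendFun f₀ (n + 1) c) = 𝒜.extendFun f₀ n (K.bd n c) := by
  induction n with
  | zero =>
    suffices h : D.d 0 ∘ₗ 𝒜.extendFun f₀ 1 = 𝒜.extendFun f₀ 0 ∘ₗ K.bd 0 from congr($h c)
    refine finsupp_hom_ext fun x => ?_
    rw [LinearMap.comp_apply, LinearMap.comp_apply, extendFun_of, d_cone_zero]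
    exact 𝒜.map_bd_mem (𝒜.extendFun_mem h₀ 0) x
  | succ n ih =>
    suffices h : D.d (n + 1) ∘ₗ 𝒜.extendFun f₀ (n + 2) = 𝒜.extendFun f₀ (n + 1) ∘ₗ K.bd (n + 1) from
      congr($h c)
    refine finsupp_hom_ext fun x => ?_
    rw [LinearMap.comp_apply, LinearMap.comp_apply, extendFun_of, d_cone, ih, bd_bd, map_zero,
      map_zero, sub_zero]
    exact 𝒜.map_bd_mem (𝒜.extendFun_mem h₀ (n + 1)) x

/-- The chain map that extends `f₀` and is given on simplices by coning off the boundary. -/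
noncomputable def extend (f₀ : K.Chains 0 →ₗ[ℚ] D.X 0) (h₀ : ∀ x, f₀ (K.of x) ∈ 𝒜.A x 0) :
    Cx.Hom K.cx D where
  f := 𝒜.extendFun f₀
  comm := 𝒜.d_extendFun h₀

/-- The chain homotopy between two carried chain maps. -/
noncomputable def homotopyFun (f g : Cx.Hom K.cx D) : ∀ n, K.Chains n →ₗ[ℚ] D.X (n + 1)
  | 0 => 0
  | n + 1 => Finsupp.linearCombination ℚ fun x => 𝒜.cone x (n + 1)
      (f.f (n + 1) (K.of x) - g.f (n + 1) (K.of x) - homotopyFun f g n (K.bd n (K.of x)))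

lemma homotopyFun_of (f g : Cx.Hom K.cx D) {n : ℕ} (x : K.S (n + 1)) :
    𝒜.homotopyFun f g (n + 1) (K.of x) = 𝒜.cone x (n + 1)
      (f.f (n + 1) (K.of x) - g.f (n + 1) (K.of x) - 𝒜.homotopyFun f g n (K.bd n (K.of x))) := by
  rw [homotopyFun]
  simp

variable {f g : Cx.Hom K.cx D}

lemma homotopyFun_mem (hf : ∀ n x, f.f n (K.of x) ∈ 𝒜.A x n) (hg : ∀ n x, g.f n (K.of x) ∈ 𝒜.A x n)
    (n : ℕ) (x : K.S n) : 𝒜.homotopyFun f g n (K.of x) ∈ 𝒜.A x (n + 1) := by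
  induction n with
  | zero => simp [homotopyFun]
  | succ n ih =>
    rw [homotopyFun_of]
    exact 𝒜.cone_mem x _ _ (Submodule.sub_mem _ (Submodule.sub_mem _ (hf _ x) (hg _ x))
      (𝒜.map_bd_mem ih x))

/-- Two carried chain maps that agree on the empty simplices are chain homotopic. -/
lemma homotopyFun_spec (hf : ∀ n x, f.f n (K.of x) ∈ 𝒜.A x n)
    (hg : ∀ n x, g.f n (K.of x) ∈ 𝒜.A x n) (h₀ : f.f 0 = g.f 0) (n : ℕ) (c : K.Chains (n + 1)) :
    f.f (n + 1) c - g.f (n + 1) c =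
      D.d (n + 1) (𝒜.homotopyFun f g (n + 1) c) + 𝒜.homotopyFun f g n (K.bd n c) := by
  suffices h : f.f (n + 1) - g.f (n + 1)
      = D.d (n + 1) ∘ₗ 𝒜.homotopyFun f g (n + 1) + 𝒜.homotopyFun f g n ∘ₗ K.bd n from congr($h c)
  refine finsupp_hom_ext fun x => ?_
  rw [LinearMap.add_apply, LinearMap.comp_apply, LinearMap.comp_apply, LinearMap.sub_apply,
    homotopyFun_of, d_cone _ _ _ _ (Submodule.sub_mem _ (Submodule.sub_mem _ (hf _ x) (hg _ x))
      (𝒜.map_bd_mem (𝒜.homotopyFun_mem hf hg n) x))]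
  suffices h : D.d n (f.f (n + 1) (K.of x) - g.f (n + 1) (K.of x)
      - 𝒜.homotopyFun f g n (K.bd n (K.of x))) = 0 by
    rw [h, map_zero]
    abel
  rw [map_sub, map_sub, f.comm, g.comm]
  cases n with
  | zero => simp [homotopyFun, h₀]
  | succ n =>
    have ih := homotopyFun_spec hf hg h₀ n (K.bd (n + 1) (K.of x))
    rw [bd_bd, map_zero, add_zero] at ih
    rw [← ih]
    exact sub_self _

end Carrier

end Carriers

end SemiSet

open SemiSet

/-! ### Singular simplices, tuples and cones -/

section Simplex

/-- The standard simplex with `n` vertices. -/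
abbrev Splx (n : ℕ) : Type := stdSimplex ℝ (Fin n)

lemma sum_stdSimplex_map {m n : ℕ} {E : Type*} [AddCommGroup E] [Module ℝ E] (f : Fin m → Fin n)
    (t : Splx m) (v : Fin n → E) :
    ∑ i, (stdSimplex.map f t) i • v i = ∑ j, t j • v (f j) := by
  rw [← Finset.sum_fiberwise Finset.univ f]
  refine Finset.sum_congr rfl fun i _ => ?_
  rw [stdSimplex.map_coe, FunOnFinite.linearMap_apply_apply, Finset.sum_smul]
  refine Finset.sum_congr rfl fun j hj => ?_
  rw [(Finset.mem_filter.1 hj).2]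

lemma stdSimplex_map_apply_of_injective {m n : ℕ} {f : Fin m → Fin n} (hf : Function.Injective f)
    (t : Splx m) (j : Fin m) : (stdSimplex.map f t) (f j) = t j := by
  rw [stdSimplex.map_coe, FunOnFinite.linearMap_apply_apply, Finset.sum_eq_single j]
  · intro k hk hkj
    exact absurd (hf (Finset.mem_filter.1 hk).2) hkj
  · simp

lemma stdSimplex_map_apply_eq_zero {m n : ℕ} {f : Fin m → Fin n} (t : Splx m) (i : Fin n)
    (hi : ∀ j, f j ≠ i) : (stdSimplex.map f t) i = 0 := by
  rw [stdSimplex.map_coe, FunOnFinite.linearMap_apply_apply]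
  refine Finset.sum_eq_zero fun k hk => ?_
  exact absurd (Finset.mem_filter.1 hk).2 (hi k)

/-- The inclusion of the face of the standard simplex opposite to the vertex `i`. -/
noncomputable def faceIncl {n : ℕ} (i : Fin (n + 1)) : C(Splx n, Splx (n + 1)) :=
  ⟨stdSimplex.map i.succAbove, stdSimplex.continuous_map _⟩

lemma faceIncl_vertex {n : ℕ} (i : Fin (n + 1)) (j : Fin n) :
    faceIncl i (stdSimplex.vertex j) = stdSimplex.vertex (i.succAbove j) :=
  stdSimplex.map_vertex _ _

lemma faceIncl_apply_succAbove {n : ℕ} (i : Fin (n + 1)) (t : Splx n) (j : Fin n) :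
    faceIncl i t (i.succAbove j) = t j :=
  stdSimplex_map_apply_of_injective Fin.succAbove_right_injective t j

lemma faceIncl_apply_self {n : ℕ} (i : Fin (n + 1)) (t : Splx n) : faceIncl i t i = 0 :=
  stdSimplex_map_apply_eq_zero t i fun j => Fin.succAbove_ne i j

lemma sum_faceIncl {n : ℕ} {E : Type*} [AddCommGroup E] [Module ℝ E] (i : Fin (n + 1))
    (t : Splx n) (v : Fin (n + 1) → E) :
    ∑ k, faceIncl i t k • v k = ∑ j, t j • v (i.succAbove j) :=
  sum_stdSimplex_map _ t v

instance : IsEmpty (Splx 0) := ⟨fun t => by simpa using (stdSimplex.sum_eq_one t)⟩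

end Simplex

/-- The semisimplicial set of singular simplices. -/
noncomputable abbrev Sing (X : Type u) [TopologicalSpace X] : SemiSet.{u} where
  S n := C(Splx n, X)
  face i σ := σ.comp (faceIncl i)
  face_face i j σ := by
    ext t
    simp only [ContinuousMap.comp_apply, faceIncl, ContinuousMap.coe_mk, stdSimplex.map_comp_apply]
    congr 2
    ext k
    exact congrArg _ (Fin.succAbove_succAbove_succAbove_predAbove i j k)

/-- The map on singular simplices induced by a continuous map. -/
@[simps]
noncomputable def singMap {X : Type u} {Y : Type v} [TopologicalSpace X] [TopologicalSpace Y]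
    (f : C(X, Y)) : SemiSet.Map (Sing X) (Sing Y) where
  app _ σ := f.comp σ
  face _ _ := rfl

/-- The semisimplicial set of all tuples of elements of `W`. -/
abbrev Tup (W : Type u) : SemiSet.{u} where
  S n := Fin n → W
  face i v := v ∘ i.succAbove
  face_face i j v := by
    ext k
    exact congrArg v (Fin.succAbove_succAbove_succAbove_predAbove i j k)

/-- The map on tuples induced by a function. -/
def tupMap {W : Type u} {W' : Type v} (f : W → W') : SemiSet.Map (Tup W) (Tup W') where
  app _ v := f ∘ v
  face _ _ := rfl

namespace SemiSet

/-- The map on chains given by an operator that adds a vertex to each simplex. -/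
noncomputable def coneLin {K : SemiSet.{u}} (k : ∀ n, K.S n → K.S (n + 1)) (n : ℕ) :
    K.Chains n →ₗ[ℚ] K.Chains (n + 1) := Finsupp.lmapDomain ℚ ℚ (k n)

variable {K : SemiSet.{u}} {k : ∀ n, K.S n → K.S (n + 1)}

lemma coneLin_of {n : ℕ} (x : K.S n) : coneLin k n (K.of x) = K.of (k n x) := by
  simp [coneLin, Finsupp.mapDomain_single]

lemma bd_coneLin_zero (h0 : ∀ n x, K.face 0 (k n x) = x) (c : K.Chains 0) :
    K.bd 0 (coneLin k 0 c) = c := by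
  suffices h : K.bd 0 ∘ₗ coneLin k 0 = LinearMap.id from congr($h c)
  refine finsupp_hom_ext fun x => ?_
  rw [LinearMap.comp_apply, coneLin_of, bd_of]
  simp [h0]

lemma bd_coneLin (h0 : ∀ n x, K.face 0 (k n x) = x)
    (h1 : ∀ n (x : K.S (n + 1)) i, K.face (Fin.succ i) (k (n + 1) x) = k n (K.face i x))
    (n : ℕ) (c : K.Chains (n + 1)) :
    K.bd (n + 1) (coneLin k (n + 1) c) = c - coneLin k n (K.bd n c) := by
  suffices h : K.bd (n + 1) ∘ₗ coneLin k (n + 1) = LinearMap.id - coneLin k n ∘ₗ K.bd n from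
    congr($h c)
  refine finsupp_hom_ext fun x => ?_
  rw [LinearMap.sub_apply, LinearMap.comp_apply, LinearMap.comp_apply, coneLin_of, bd_of, bd_of,
    Fin.sum_univ_succ, h0, map_sum]
  simp only [h1, Fin.val_succ, map_smul, coneLin_of, pow_succ, LinearMap.id_apply, Fin.val_zero,
    pow_zero, one_smul, mul_neg_one, neg_smul, Finset.sum_neg_distrib]
  exact (sub_eq_add_neg _ _).symm

end SemiSet

section TupCone

variable {W : Type u}

/-- Adding the vertex `p` at the front of a tuple. -/
def tupCone (p : W) (n : ℕ) (v : (Tup W).S n) : (Tup W).S (n + 1) := Fin.cons p v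

lemma face_zero_tupCone (p : W) (n : ℕ) (v : (Tup W).S n) :
    (Tup W).face 0 (tupCone p n v) = v := by
  ext i
  simp [tupCone]

lemma face_succ_tupCone (p : W) (n : ℕ) (v : (Tup W).S (n + 1)) (i : Fin (n + 1)) :
    (Tup W).face i.succ (tupCone p (n + 1) v) = tupCone p n ((Tup W).face i v) := by
  ext j
  refine Fin.cases ?_ (fun j => ?_) j <;> simp [tupCone]

end TupCone

section SingCone

variable {E : Type u} [NormedAddCommGroup E] [NormedSpace ℝ E]

/-- The projection of a point of a standard simplex from the vertex `0` to the opposite face. -/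
noncomputable def tailPt {n : ℕ} (t : Splx (n + 1)) (h : t 0 ≠ 1) : Splx n :=
  ⟨fun i => t i.succ / (1 - t 0), fun i => div_nonneg (stdSimplex.zero_le t _)
    (sub_nonneg.2 (stdSimplex.le_one t _)), by
    have h1 := (stdSimplex.sum_eq_one t)
    rw [Fin.sum_univ_succ] at h1
    rw [← Finset.sum_div, div_eq_one_iff_eq (sub_ne_zero.2 (Ne.symm h))]
    linarith⟩

lemma tailPt_apply {n : ℕ} (t : Splx (n + 1)) (h : t 0 ≠ 1) (i : Fin n) :
    tailPt t h i = t i.succ / (1 - t 0) := rfl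

open Classical in
/-- The join of the point `p` with the singular simplex `σ`, as a function. -/
noncomputable def coneFun (p : E) {n : ℕ} (σ : C(Splx n, E)) (t : Splx (n + 1)) : E :=
  if h : t 0 = 1 then p else t 0 • p + (1 - t 0) • σ (tailPt t h)

lemma continuous_coord {n : ℕ} (i : Fin n) : Continuous fun t : Splx n => t i :=
  (continuous_apply i).comp continuous_subtype_val

lemma continuous_coneFun (p : E) {n : ℕ} (σ : C(Splx n, E)) : Continuous (coneFun p σ) := by
  rw [continuous_iff_continuousAt]
  intro t
  by_cases h : t 0 = 1
  · obtain ⟨C, hC⟩ := (isCompact_range σ.continuous).isBounded.exists_norm_le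
    have hb : ∀ s : Splx (n + 1), ‖coneFun p σ s - p‖ ≤ (1 - s 0) * (C + ‖p‖) := by
      intro s
      by_cases hs : s 0 = 1
      · simp [coneFun, hs]
      · have : coneFun p σ s - p = (1 - s 0) • (σ (tailPt s hs) - p) := by
          rw [coneFun, dif_neg hs]
          module
        rw [this, norm_smul, Real.norm_of_nonneg (sub_nonneg.2 (stdSimplex.le_one s _))]
        refine mul_le_mul_of_nonneg_left ?_ (sub_nonneg.2 (stdSimplex.le_one s _))
        exact (norm_sub_le _ _).trans (add_le_add_left (hC _ ⟨_, rfl⟩) _)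
    have hp : coneFun p σ t = p := by simp [coneFun, h]
    rw [ContinuousAt, hp, tendsto_iff_norm_sub_tendsto_zero]
    refine squeeze_zero (fun _ => norm_nonneg _) hb ?_
    have : Continuous fun s : Splx (n + 1) => (1 - s 0) * (C + ‖p‖) :=
      (continuous_const.sub (continuous_coord 0)).mul continuous_const
    simpa [h] using this.tendsto t
  · have ho : IsOpen {s : Splx (n + 1) | s 0 ≠ 1} :=
      isOpen_ne_fun (continuous_coord 0) continuous_const
    refine ContinuousOn.continuousAt (s := {s | s 0 ≠ 1}) ?_ (ho.mem_nhds h)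
    rw [continuousOn_iff_continuous_domRestrict]
    have ht : Continuous fun s : {s : Splx (n + 1) | s 0 ≠ 1} => tailPt s.1 s.2 := by
      refine Continuous.subtype_mk (continuous_pi fun i => ?_) _
      refine ((continuous_coord i.succ).comp continuous_subtype_val).div
        (continuous_const.sub ((continuous_coord 0).comp continuous_subtype_val)) ?_
      intro s
      exact sub_ne_zero.2 (Ne.symm s.2)
    have h0 : Continuous fun s : {s : Splx (n + 1) | s 0 ≠ 1} => s.1 0 :=
      (continuous_coord 0).comp continuous_subtype_val
    have : Continuous fun s : {s : Splx (n + 1) | s 0 ≠ 1} =>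
        s.1 0 • p + (1 - s.1 0) • σ (tailPt s.1 s.2) :=
      (h0.smul continuous_const).add ((continuous_const.sub h0).smul (σ.continuous.comp ht))
    convert this using 2 with s
    exact dif_neg s.2

/-- The join of the point `p` with a singular simplex of a normed space. -/
noncomputable def singCone (p : E) (n : ℕ) (σ : (Sing E).S n) : (Sing E).S (n + 1) :=
  ⟨coneFun p σ, continuous_coneFun p σ⟩

lemma face_zero_singCone (p : E) (n : ℕ) (σ : (Sing E).S n) :
    (Sing E).face 0 (singCone p n σ) = σ := by
  ext t
  have h0 : faceIncl 0 t 0 = 0 := faceIncl_apply_self 0 t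
  have h : faceIncl 0 t 0 ≠ 1 := by simp [h0]
  change coneFun p σ (faceIncl 0 t) = σ t
  rw [coneFun, dif_neg h, h0, zero_smul, zero_add, sub_zero, one_smul]
  congr 1
  ext i
  rw [tailPt_apply, h0, sub_zero, div_one]
  exact faceIncl_apply_succAbove 0 t i

lemma face_succ_singCone (p : E) (n : ℕ) (σ : (Sing E).S (n + 1)) (i : Fin (n + 1)) :
    (Sing E).face i.succ (singCone p (n + 1) σ) = singCone p n ((Sing E).face i σ) := by
  ext t
  have h0 : faceIncl i.succ t 0 = t 0 := by
    simpa using faceIncl_apply_succAbove i.succ t 0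
  change coneFun p σ (faceIncl i.succ t) = coneFun p (σ.comp (faceIncl i)) t
  by_cases h : t 0 = 1
  · simp [coneFun, h0, h]
  · rw [coneFun, coneFun, dif_neg h, dif_neg (h0 ▸ h), ContinuousMap.comp_apply]
    suffices hs : tailPt (faceIncl i.succ t) (h0 ▸ h) = faceIncl i (tailPt t h) by rw [hs, h0]
    ext j
    rw [tailPt_apply, h0]
    rcases Fin.eq_self_or_eq_succAbove i j with rfl | ⟨k, rfl⟩
    · rw [faceIncl_apply_self, faceIncl_apply_self, zero_div]
    · rw [faceIncl_apply_succAbove, ← Fin.succ_succAbove_succ, faceIncl_apply_succAbove,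
        tailPt_apply]

lemma singCone_range_subset {B : Set E} (hB : Convex ℝ B) {p : E} (hp : p ∈ B) {n : ℕ}
    {σ : (Sing E).S n} (hσ : Set.range σ ⊆ B) : Set.range (singCone p n σ) ⊆ B := by
  rintro _ ⟨t, rfl⟩
  change coneFun p σ t ∈ B
  by_cases h : t 0 = 1
  · simpa [coneFun, h] using hp
  · rw [coneFun, dif_neg h]
    exact hB hp (hσ ⟨_, rfl⟩) (stdSimplex.zero_le t 0) (sub_nonneg.2 (stdSimplex.le_one t 0))
      (by ring)

/-- The affine singular simplex with given vertices. -/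
noncomputable def affMap (E : Type u) [NormedAddCommGroup E] [NormedSpace ℝ E] :
    SemiSet.Map (Tup E) (Sing E) where
  app _ v := ⟨fun t => ∑ i, t i • v i,
    continuous_finsetSum _ fun i _ => (continuous_coord i).smul continuous_const⟩
  face i v := by
    ext t
    exact (sum_faceIncl i t v).symm

lemma affMap_range_subset {B : Set E} (hB : Convex ℝ B) {n : ℕ} {v : (Tup E).S n}
    (hv : ∀ i, v i ∈ B) : Set.range ((affMap E).app n v) ⊆ B := by
  rintro _ ⟨t, rfl⟩
  exact hB.sum_mem (fun i _ => stdSimplex.zero_le t i) (stdSimplex.sum_eq_one t) fun i _ => hv i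

end SingCone

/-! ### Barycentric subdivision -/

section Comb

/-- The convex combination of the points `v i` with weights `t i`. -/
noncomputable def comb {m n : ℕ} (v : Fin n → Splx m) (t : Splx n) : Splx m :=
  ⟨∑ i, t i • (v i).1, (convex_stdSimplex ℝ (Fin m)).sum_mem
    (fun i _ => stdSimplex.zero_le t i) (stdSimplex.sum_eq_one t) fun i _ => (v i).2⟩

lemma coe_comb {m n : ℕ} (v : Fin n → Splx m) (t : Splx n) :
    (comb v t).1 = ∑ i, t i • (v i).1 := rfl

lemma continuous_comb {m n : ℕ} (v : Fin n → Splx m) : Continuous (comb v) :=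
  Continuous.subtype_mk
    (continuous_finsetSum _ fun i _ => (continuous_coord i).smul continuous_const) _

/-- Maps of standard simplices that preserve convex combinations. -/
def IsAff {m m' : ℕ} (g : Splx m → Splx m') : Prop :=
  ∀ (n : ℕ) (v : Fin n → Splx m) (t : Splx n), g (comb v t) = comb (g ∘ v) t

lemma isAff_comb {m n : ℕ} (w : Fin n → Splx m) : IsAff (comb w) := by
  intro k v t
  apply Subtype.ext
  have h : ∀ l, (comb v t) l = ∑ i, t i * v i l := by
    intro l
    change (∑ i, t i • (v i).1) l = _
    rw [Finset.sum_apply]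
    rfl
  simp only [coe_comb, Function.comp_apply, Finset.smul_sum, smul_smul, h, Finset.sum_smul]
  exact Finset.sum_comm

lemma comb_vertex_right {m n : ℕ} (v : Fin n → Splx m) (i : Fin n) :
    comb v (stdSimplex.vertex i) = v i := by
  apply Subtype.ext
  rw [coe_comb, Finset.sum_eq_single i]
  · simp
  · intro j _ hj
    simp [hj]
  · simp

lemma comb_vertex_left {n : ℕ} (t : Splx n) : comb stdSimplex.vertex t = t := by
  apply Subtype.ext
  rw [coe_comb]
  ext j
  rw [Finset.sum_apply, Finset.sum_eq_single j]
  · change t j * (Pi.single j 1 : Fin n → ℝ) j = t j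
    simp
  · intro i _ hi
    change t i * (Pi.single i 1 : Fin n → ℝ) j = 0
    simp [hi.symm]
  · simp

lemma comb_map {m n k : ℕ} (v : Fin n → Splx m) (f : Fin k → Fin n) (t : Splx k) :
    comb v (stdSimplex.map f t) = comb (v ∘ f) t :=
  Subtype.ext (sum_stdSimplex_map f t _)

lemma dist_comb_le {m n : ℕ} (v : Fin n → Splx m) (t : Splx n) (c : Splx m) {R : ℝ}
    (h : ∀ i, dist (v i) c ≤ R) : dist (comb v t) c ≤ R := by
  have := (convex_closedBall c.1 R).sum_mem
    (fun i (_ : i ∈ Finset.univ) => stdSimplex.zero_le t i) (stdSimplex.sum_eq_one t)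
    (z := fun i => (v i).1) fun i _ => Metric.mem_closedBall.2 (h i)
  exact Metric.mem_closedBall.1 this

/-- The barycenter of a nonempty tuple. -/
noncomputable def bary {m n : ℕ} (v : Fin (n + 1) → Splx m) : Splx m := comb v stdSimplex.barycenter

lemma dist_bary_le {m n : ℕ} (v : Fin (n + 1) → Splx m) {D : ℝ}
    (h : ∀ i j, dist (v i) (v j) ≤ D) (k : Fin (n + 1)) :
    dist (v k) (bary v) ≤ (1 - 1 / ((n : ℝ) + 1)) * D := by
  have hn : (n : ℝ) + 1 ≠ 0 := by positivity
  have hb : (bary v).1 = ((n : ℝ) + 1)⁻¹ • ∑ i, (v i).1 := by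
    rw [bary, coe_comb, Finset.smul_sum]
    refine Finset.sum_congr rfl fun i _ => ?_
    congr 1
    exact (stdSimplex.barycenter_apply i).trans (by simp)
  have hd : ((v k).1 - (bary v).1) = ((n : ℝ) + 1)⁻¹ • ∑ i ∈ Finset.univ.erase k,
      ((v k).1 - (v i).1) := by
    rw [hb, Finset.sum_erase _ (sub_self _), Finset.sum_sub_distrib, smul_sub]
    simp only [Finset.sum_const, Finset.card_univ, Fintype.card_fin]
    rw [← Nat.cast_smul_eq_nsmul ℝ, smul_smul, Nat.cast_succ, inv_mul_cancel₀ hn, one_smul]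
  rw [Subtype.dist_eq, dist_eq_norm, hd, norm_smul, Real.norm_of_nonneg (by positivity)]
  have hs : ‖∑ i ∈ Finset.univ.erase k, ((v k).1 - (v i).1)‖ ≤ n * D := by
    refine (norm_sum_le_of_le (n := fun _ => D) _ fun i _ => ?_).trans ?_
    · rw [← dist_eq_norm]
      exact h k i
    · simp
  calc ((n : ℝ) + 1)⁻¹ * _ ≤ ((n : ℝ) + 1)⁻¹ * (n * D) := by gcongr
    _ = _ := by field_simp; ring

lemma IsAff.bary {m m' n : ℕ} {g : Splx m → Splx m'} (hg : IsAff g) (v : Fin (n + 1) → Splx m) :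
    g (_root_.bary v) = _root_.bary (g ∘ v) := hg _ _ _

/-- The affine singular simplices of a standard simplex. -/
noncomputable def realMap (m : ℕ) : SemiSet.Map (Tup (Splx m)) (Sing (Splx m)) where
  app _ v := ⟨comb v, continuous_comb v⟩
  face i v := by
    ext1 t
    exact (comb_map v _ t).symm

lemma realMap_lin_tupMap {m m' : ℕ} (g : C(Splx m, Splx m')) (hg : IsAff g) (n : ℕ)
    (c : (Tup (Splx m)).Chains n) :
    (realMap m').lin n ((tupMap g).lin n c) = (singMap g).lin n ((realMap m).lin n c) := by
  suffices h : (realMap m').lin n ∘ₗ (tupMap g).lin n = (singMap g).lin n ∘ₗ (realMap m).lin n from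
    congr($h c)
  refine finsupp_hom_ext fun v => ?_
  rw [LinearMap.comp_apply, LinearMap.comp_apply, SemiSet.Map.lin_of, SemiSet.Map.lin_of,
    SemiSet.Map.lin_of, SemiSet.Map.lin_of]
  congr 1
  ext1 t
  exact (hg _ _ _).symm

end Comb

section NatOp

/-- An operation on the chains of tuples of points of standard simplices that commutes with affine
maps. -/
structure NatOp (n k : ℕ) where
  op : ∀ m, (Tup (Splx m)).Chains n →ₗ[ℚ] (Tup (Splx m)).Chains k
  nat : ∀ {m m'} (g : Splx m → Splx m'), IsAff g → ∀ c,
    (tupMap g).lin k (op m c) = op m' ((tupMap g).lin n c)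

/-- The composition of natural operations. -/
noncomputable def NatOp.comp {n k l : ℕ} (F : NatOp k l) (G : NatOp n k) : NatOp n l where
  op m := F.op m ∘ₗ G.op m
  nat g hg c := by
    rw [LinearMap.comp_apply, LinearMap.comp_apply, F.nat g hg, G.nat g hg]

/-- The boundary as a natural operation. -/
noncomputable def NatOp.bd (n : ℕ) : NatOp (n + 1) n where
  op m := (Tup (Splx m)).bd n
  nat g _ c := ((tupMap g).bd_lin n c).symm

/-- The identity as a natural operation. -/
noncomputable def NatOp.id (n : ℕ) : NatOp n n where
  op _ := LinearMap.id
  nat _ _ _ := rfl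

variable (X : Type u) [TopologicalSpace X]

/-- The operation on singular chains defined by a natural operation, whose value at a singular
simplex is the image of its value at the tuple of vertices of the standard simplex. -/
noncomputable def NatOp.sing {n k : ℕ} (F : NatOp n k) :
    (Sing X).Chains n →ₗ[ℚ] (Sing X).Chains k :=
  Finsupp.linearCombination ℚ fun σ => (singMap σ).lin k
    ((realMap n).lin k (F.op n ((Tup (Splx n)).of stdSimplex.vertex)))

variable {X}

lemma NatOp.sing_of {n k : ℕ} (F : NatOp n k) (σ : (Sing X).S n) :
    F.sing X ((Sing X).of σ) = (singMap σ).lin k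
      ((realMap n).lin k (F.op n ((Tup (Splx n)).of stdSimplex.vertex))) := by
  simp [sing]

lemma singMap_comp_lin {Y : Type v} {Z : Type w} [TopologicalSpace Y] [TopologicalSpace Z]
    (g : C(Y, Z)) (f : C(X, Y)) (n : ℕ) (c : (Sing X).Chains n) :
    (singMap (g.comp f)).lin n c = (singMap g).lin n ((singMap f).lin n c) := by
  suffices h : (singMap (g.comp f)).lin n = (singMap g).lin n ∘ₗ (singMap f).lin n from congr($h c)
  refine finsupp_hom_ext fun σ => ?_
  rw [LinearMap.comp_apply, SemiSet.Map.lin_of, SemiSet.Map.lin_of, SemiSet.Map.lin_of]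
  rfl

lemma NatOp.sing_singMap {Y : Type v} [TopologicalSpace Y] {n k : ℕ} (F : NatOp n k) (f : C(X, Y))
    (c : (Sing X).Chains n) :
    (singMap f).lin k (F.sing X c) = F.sing Y ((singMap f).lin n c) := by
  suffices h : (singMap f).lin k ∘ₗ F.sing X = F.sing Y ∘ₗ (singMap f).lin n from congr($h c)
  refine finsupp_hom_ext fun σ => ?_
  rw [LinearMap.comp_apply, LinearMap.comp_apply, SemiSet.Map.lin_of, sing_of, sing_of,
    ← singMap_comp_lin]
  rfl

lemma NatOp.sing_realMap {m n k : ℕ} (F : NatOp n k) (c : (Tup (Splx m)).Chains n) :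
    F.sing (Splx m) ((realMap m).lin n c) = (realMap m).lin k (F.op m c) := by
  suffices h : F.sing (Splx m) ∘ₗ (realMap m).lin n = (realMap m).lin k ∘ₗ F.op m from congr($h c)
  refine finsupp_hom_ext fun v => ?_
  rw [LinearMap.comp_apply, LinearMap.comp_apply, SemiSet.Map.lin_of, sing_of]
  have h := realMap_lin_tupMap ⟨comb v, continuous_comb v⟩ (isAff_comb v) k
    (F.op n ((Tup (Splx n)).of stdSimplex.vertex))
  refine h.symm.trans (congrArg _ ?_)
  refine (F.nat (comb v) (isAff_comb v) _).trans ?_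
  rw [SemiSet.Map.lin_of]
  congr 2
  ext1 i
  exact comb_vertex_right v i

lemma NatOp.sing_comp {n k l : ℕ} (F : NatOp k l) (G : NatOp n k) (c : (Sing X).Chains n) :
    (F.comp G).sing X c = F.sing X (G.sing X c) := by
  suffices h : (F.comp G).sing X = F.sing X ∘ₗ G.sing X from congr($h c)
  refine finsupp_hom_ext fun σ => ?_
  rw [LinearMap.comp_apply, sing_of, sing_of, ← sing_singMap, sing_realMap]
  rfl

lemma sing_vertex {n : ℕ} (σ : (Sing X).S n) : (singMap σ).lin n
    ((realMap n).lin n ((Tup (Splx n)).of stdSimplex.vertex)) = (Sing X).of σ := by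
  rw [SemiSet.Map.lin_of, SemiSet.Map.lin_of]
  congr 1
  ext1 t
  exact congrArg σ (comb_vertex_left t)

lemma NatOp.sing_id (n : ℕ) (c : (Sing X).Chains n) : (NatOp.id n).sing X c = c := by
  suffices h : (NatOp.id n).sing X = LinearMap.id from congr($h c)
  refine finsupp_hom_ext fun σ => ?_
  rw [sing_of]
  exact sing_vertex σ

lemma NatOp.sing_bd (n : ℕ) (c : (Sing X).Chains (n + 1)) :
    (NatOp.bd n).sing X c = (Sing X).bd n c := by
  suffices h : (NatOp.bd n).sing X = (Sing X).bd n from congr($h c)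
  refine finsupp_hom_ext fun σ => ?_
  rw [sing_of]
  change (singMap σ).lin n ((realMap _).lin n ((Tup _).bd n _)) = _
  rw [← SemiSet.Map.bd_lin, ← SemiSet.Map.bd_lin, sing_vertex]

/-- The chains supported in the simplices with image in `B`. -/
noncomputable abbrev chainsIn (B : Set X) (n : ℕ) : Submodule ℚ ((Sing X).Chains n) :=
  (Sing X).subChains (fun _ σ => Set.range σ ⊆ B) n

lemma chainsIn_mono {B B' : Set X} (h : B ⊆ B') (n : ℕ) : chainsIn B n ≤ chainsIn B' n :=
  Finsupp.supported_mono fun _ hσ => Set.Subset.trans hσ h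

lemma singMap_mem_chainsIn {Y : Type v} [TopologicalSpace Y] (f : C(X, Y)) {n : ℕ}
    (c : (Sing X).Chains n) : (singMap f).lin n c ∈ chainsIn (Set.range f) n := by
  refine finsupp_map_mem (A := Set.univ) _ (fun σ _ => ?_) (by simp)
  rw [SemiSet.Map.lin_of]
  exact Finsupp.single_mem_supported _ _ (Set.range_comp_subset_range σ f)

lemma NatOp.sing_mem_chainsIn {n k : ℕ} (F : NatOp n k) {B : Set X} {c : (Sing X).Chains n}
    (hc : c ∈ chainsIn B n) : F.sing X c ∈ chainsIn B k := by
  refine finsupp_map_mem _ (fun σ hσ => ?_) hc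
  rw [sing_of]
  exact chainsIn_mono hσ k (singMap_mem_chainsIn σ _)

end NatOp

section Subdivision

/-- The contractions of the complex of tuples of points that add the barycenter of a given tuple.
The chain map that they define is the barycentric subdivision. -/
noncomputable def sdCarrier (m : ℕ) : Carrier (Tup (Splx m)) (Tup (Splx m)).cx where
  A _ _ := ⊤
  mono _ _ _ := le_rfl
  cone v k := coneLin (K := Tup (Splx m)) (tupCone (bary v)) k
  cone_mem _ _ _ _ := trivial
  d_cone _ k c _ := bd_coneLin (face_zero_tupCone _) (face_succ_tupCone _) k c
  d_cone_zero _ c _ := bd_coneLin_zero (face_zero_tupCone _) c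

/-- The barycentric subdivision of chains of tuples. -/
noncomputable def sdTup (m : ℕ) : Cx.Hom (Tup (Splx m)).cx (Tup (Splx m)).cx :=
  (sdCarrier m).extend LinearMap.id fun _ => trivial

lemma sdTup_of {m n : ℕ} (v : (Tup (Splx m)).S (n + 1)) :
    (sdTup m).f (n + 1) ((Tup (Splx m)).of v) = coneLin (K := Tup (Splx m)) (tupCone (bary v)) n
      ((sdTup m).f n ((Tup (Splx m)).bd n ((Tup (Splx m)).of v))) :=
  (sdCarrier m).extendFun_of _ v

/-- The homotopy from the barycentric subdivision to the identity. -/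
noncomputable def sdHtpyTup (m n : ℕ) :
    (Tup (Splx m)).Chains n →ₗ[ℚ] (Tup (Splx m)).Chains (n + 1) :=
  (sdCarrier m).homotopyFun (sdTup m) (Cx.Hom.id _) n

lemma sdHtpyTup_of {m n : ℕ} (v : (Tup (Splx m)).S (n + 1)) :
    sdHtpyTup m (n + 1) ((Tup (Splx m)).of v) =
      coneLin (K := Tup (Splx m)) (tupCone (bary v)) (n + 1)
        ((sdTup m).f (n + 1) ((Tup (Splx m)).of v) - (Tup (Splx m)).of v
          - sdHtpyTup m n ((Tup (Splx m)).bd n ((Tup (Splx m)).of v))) :=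
  (sdCarrier m).homotopyFun_of _ _ v

lemma sdHtpyTup_spec (m n : ℕ) (c : (Tup (Splx m)).Chains (n + 1)) :
    (sdTup m).f (n + 1) c - c = (Tup (Splx m)).bd (n + 1) (sdHtpyTup m (n + 1) c)
      + sdHtpyTup m n ((Tup (Splx m)).bd n c) :=
  (sdCarrier m).homotopyFun_spec (f := sdTup m) (g := Cx.Hom.id _) (fun _ _ => Submodule.mem_top)
    (fun _ _ => Submodule.mem_top) rfl n c

lemma tupMap_coneLin {W : Type u} {W' : Type v} (g : W → W') (p : W) (n : ℕ)
    (c : (Tup W).Chains n) :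
    (tupMap g).lin (n + 1) (coneLin (K := Tup W) (tupCone p) n c)
      = coneLin (K := Tup W') (tupCone (g p)) n ((tupMap g).lin n c) := by
  suffices h : (tupMap g).lin (n + 1) ∘ₗ coneLin (K := Tup W) (tupCone p) n
      = coneLin (K := Tup W') (tupCone (g p)) n ∘ₗ (tupMap g).lin n from congr($h c)
  refine finsupp_hom_ext fun v => ?_
  rw [LinearMap.comp_apply, LinearMap.comp_apply, coneLin_of, Map.lin_of, Map.lin_of, coneLin_of]
  congr 1
  ext1 i
  refine Fin.cases ?_ (fun j => ?_) i <;> rfl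

/-- Barycentric subdivision as a natural operation. -/
@[simps]
noncomputable def NatOp.sd (n : ℕ) : NatOp n n where
  op m := (sdTup m).f n
  nat {m m'} g hg c := by
    induction n with
    | zero => rfl
    | succ n ih =>
      suffices h : (tupMap g).lin (n + 1) ∘ₗ (sdTup m).f (n + 1)
        = (sdTup m').f (n + 1) ∘ₗ (tupMap g).lin (n + 1) from congr($h c)
      refine finsupp_hom_ext fun v => ?_
      rw [LinearMap.comp_apply, LinearMap.comp_apply, Map.lin_of, sdTup_of, sdTup_of,
        tupMap_coneLin, ih, hg.bary, ← Map.bd_lin, Map.lin_of]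
      rfl

/-- The homotopy from the barycentric subdivision to the identity, as a natural operation. -/
noncomputable def NatOp.sdHtpy (n : ℕ) : NatOp n (n + 1) where
  op m := sdHtpyTup m n
  nat {m m'} g hg c := by
    induction n with
    | zero => simp [sdHtpyTup, Carrier.homotopyFun]
    | succ n ih =>
      suffices h : (tupMap g).lin (n + 2) ∘ₗ sdHtpyTup m (n + 1)
        = sdHtpyTup m' (n + 1) ∘ₗ (tupMap g).lin (n + 1) from congr($h c)
      refine finsupp_hom_ext fun v => ?_
      have hsd := (NatOp.sd (n + 1)).nat g hg ((Tup (Splx m)).of v)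
      simp only [NatOp.sd_op] at hsd
      rw [LinearMap.comp_apply, LinearMap.comp_apply, Map.lin_of, sdHtpyTup_of, sdHtpyTup_of,
        tupMap_coneLin, map_sub ((tupMap g).lin _), map_sub ((tupMap g).lin _), hsd, ih, hg.bary,
        ← Map.bd_lin, Map.lin_of]
      rfl

variable (X : Type u) [TopologicalSpace X]

/-- The barycentric subdivision of singular chains. -/
@[simps]
noncomputable def sdSing : Cx.Hom (Sing X).cx (Sing X).cx where
  f n := (NatOp.sd n).sing X
  comm n c := by
    rw [← NatOp.sing_bd, ← NatOp.sing_bd, ← NatOp.sing_comp, ← NatOp.sing_comp]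
    congr 1
    refine finsupp_hom_ext fun σ => ?_
    rw [NatOp.sing_of, NatOp.sing_of]
    congr 2
    exact (sdTup _).comm n _

variable {X}

lemma sdHtpy_spec (n : ℕ) (c : (Sing X).Chains (n + 1)) :
    (sdSing X).f (n + 1) c - c = (Sing X).bd (n + 1) ((NatOp.sdHtpy (n + 1)).sing X c)
      + (NatOp.sdHtpy n).sing X ((Sing X).bd n c) := by
  rw [← NatOp.sing_bd, ← NatOp.sing_bd, ← NatOp.sing_comp, ← NatOp.sing_comp]
  suffices h : (NatOp.sd (n + 1)).sing X - LinearMap.id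
      = ((NatOp.bd (n + 1)).comp (NatOp.sdHtpy (n + 1))).sing X
        + ((NatOp.sdHtpy n).comp (NatOp.bd n)).sing X from congr($h c)
  refine finsupp_hom_ext fun σ => ?_
  rw [LinearMap.sub_apply, LinearMap.add_apply, NatOp.sing_of, NatOp.sing_of, NatOp.sing_of,
    LinearMap.id_apply, ← map_add, ← map_add]
  refine (congrArg _ (sing_vertex σ).symm).trans ?_
  rw [← map_sub, ← map_sub]
  congr 2
  exact sdHtpyTup_spec _ n _

end Subdivision

/-! ### Small simplices -/

section Mesh

/-- The tuple `w` of length `n` is contained in each ball that contains `v`, and its diameter is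
smaller than that of `v` by the factor `1 - 1 / n`. -/
def Refines {m n : ℕ} (v w : Fin n → Splx m) : Prop :=
  (∀ c R, (∀ i, dist (v i) c ≤ R) → ∀ i, dist (w i) c ≤ R) ∧
  ∀ D, (∀ i j, dist (v i) (v j) ≤ D) → ∀ i j, dist (w i) (w j) ≤ (1 - 1 / (n : ℝ)) * D

lemma refines_cons {m n : ℕ} (v : Fin (n + 1) → Splx m) (k : Fin (n + 1)) (w : Fin n → Splx m)
    (h : Refines (v ∘ k.succAbove) w) : Refines v (Fin.cons (bary v) w) := by
  refine ⟨fun c R hR i => ?_, fun D hD i j => ?_⟩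
  · refine Fin.cases ?_ (fun i => ?_) i
    · exact dist_comb_le v _ c hR
    · exact h.1 c R (fun i => hR _) i
  · have hb : ∀ i, dist (w i) (bary v) ≤ (1 - 1 / ((n + 1 : ℕ) : ℝ)) * D := by
      refine h.1 _ _ fun i => ?_
      rw [Nat.cast_succ]
      exact dist_bary_le v hD _
    have hD0 : 0 ≤ D := dist_nonneg.trans (hD 0 0)
    have hn : 0 ≤ (1 - 1 / ((n + 1 : ℕ) : ℝ)) * D := by
      refine mul_nonneg (sub_nonneg.2 ?_) hD0
      rw [div_le_one (by positivity)]
      simp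
    refine Fin.cases ?_ (fun i => ?_) i <;> refine Fin.cases ?_ (fun j => ?_) j
    · simpa using hn
    · simpa [dist_comm] using hb j
    · simpa using hb i
    · refine (h.2 D (fun _ _ => hD _ _) i j).trans ?_
      have : (0 : ℝ) < n := by exact_mod_cast i.pos
      push_cast
      gcongr
      linarith

lemma sdTup_refines {m n : ℕ} (v : (Tup (Splx m)).S n) :
    (sdTup m).f n ((Tup (Splx m)).of v) ∈ Finsupp.supported ℚ ℚ {w | Refines v w} := by
  induction n with
  | zero =>
    refine Finsupp.single_mem_supported _ _ ?_
    exact ⟨fun _ _ _ i => i.elim0, fun _ _ i => i.elim0⟩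
  | succ n ih =>
    rw [sdTup_of, bd_of, map_sum, map_sum]
    refine Submodule.sum_mem _ fun k _ => ?_
    rw [map_smul, map_smul]
    refine Submodule.smul_mem _ _ (finsupp_map_mem _ (fun w hw => ?_) (ih _))
    rw [coneLin_of]
    exact Finsupp.single_mem_supported _ _ (refines_cons v k w hw)

end Mesh

namespace Cx.Hom

/-- The iterates of a chain map. -/
def pow {C : Cx.{u}} (φ : Hom C C) : ℕ → Hom C C
  | 0 => id C
  | r + 1 => φ.comp (pow φ r)

lemma pow_onH {C : Cx.{u}} {φ : Hom C C} {n : ℕ} (h : φ.onH n = LinearMap.id) (r : ℕ) :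
    (φ.pow r).onH n = LinearMap.id := by
  induction r with
  | zero => exact onH_id n
  | succ r ih => rw [pow, onH_comp, h, ih, LinearMap.id_comp]

end Cx.Hom

section SdPow

variable {X : Type u} [TopologicalSpace X]

lemma sdSing_onH (n : ℕ) : (sdSing X).onH n = LinearMap.id := by
  rw [← Cx.Hom.onH_id]
  exact Cx.Hom.onH_eq_of_homotopy _ _ (fun n => (NatOp.sdHtpy n).sing X) sdHtpy_spec n

lemma sdPow_mem_chainsIn (r : ℕ) {n : ℕ} {B : Set X} {c : (Sing X).Chains n}
    (hc : c ∈ chainsIn B n) : ((sdSing X).pow r).f n c ∈ chainsIn B n := by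
  induction r with
  | zero => exact hc
  | succ r ih => exact (NatOp.sd n).sing_mem_chainsIn ih

/-- The simplices of an iterated subdivision of `σ` are the restrictions of `σ` to simplices of
exponentially small diameter. -/
lemma sdPow_of_mem (r : ℕ) {n : ℕ} (σ : (Sing X).S n) :
    ((sdSing X).pow r).f n ((Sing X).of σ) ∈ Finsupp.supported ℚ ℚ
      {τ : (Sing X).S n | ∃ w : Fin n → Splx n, τ = σ.comp ⟨comb w, continuous_comb w⟩ ∧
        ∀ i j, dist (w i) (w j) ≤
          (1 - 1 / (n : ℝ)) ^ r * Metric.diam (Set.univ : Set (Splx n))} := by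
  induction r with
  | zero =>
    refine Finsupp.single_mem_supported _ _ ⟨stdSimplex.vertex, ?_, fun i j => ?_⟩
    · ext1 t
      exact congrArg σ (comb_vertex_left t).symm
    · rw [pow_zero, one_mul]
      exact Metric.dist_le_diam_of_mem isCompact_univ.isBounded trivial trivial
  | succ r ih =>
    refine finsupp_map_mem ((sdSing X).f n) ?_ ih
    rintro _ ⟨w, rfl, hw⟩
    have h : (Sing X).of (σ.comp ⟨comb w, continuous_comb w⟩)
        = (singMap σ).lin n ((realMap n).lin n ((Tup (Splx n)).of w)) := by
      rw [Map.lin_of, Map.lin_of]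
      rfl
    suffices h' : (sdSing X).f n ((Sing X).of (σ.comp ⟨comb w, continuous_comb w⟩)) ∈ _ from h'
    rw [h, sdSing_f, ← NatOp.sing_singMap, NatOp.sing_realMap]
    refine finsupp_map_mem ((singMap σ).lin n ∘ₗ (realMap n).lin n) (fun u hu => ?_)
      (sdTup_refines w)
    rw [LinearMap.comp_apply, Map.lin_of, Map.lin_of]
    refine Finsupp.single_mem_supported _ _ ⟨u, rfl, fun i j => ?_⟩
    rw [pow_succ', mul_assoc]
    exact hu.2 _ hw i j

end SdPow

section Small

variable (X : Type u) [MetricSpace X]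

/-- The property of having diameter less than `ε`, for a singular simplex. -/
def IsSmall (ε : ℝ) (n : ℕ) (σ : (Sing X).S n) : Prop := ∀ s t, dist (σ s) (σ t) < ε

variable {X}

lemma IsSmall.face {ε : ℝ} (n : ℕ) (i : Fin (n + 1)) (σ : (Sing X).S (n + 1))
    (h : IsSmall X ε (n + 1) σ) : IsSmall X ε n ((Sing X).face i σ) := fun _ _ => h _ _

lemma IsSmall.of_range_subset {ε : ℝ} {n k : ℕ} {σ : (Sing X).S n} {τ : (Sing X).S k}
    (h : IsSmall X ε n σ) (hτ : Set.range τ ⊆ Set.range σ) : IsSmall X ε k τ := by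
  intro s t
  obtain ⟨s', hs⟩ := hτ ⟨s, rfl⟩
  obtain ⟨t', ht⟩ := hτ ⟨t, rfl⟩
  rw [← hs, ← ht]
  exact h s' t'

variable (X) in
/-- The semisimplicial set of singular simplices of diameter less than `ε`. -/
noncomputable abbrev SmallSing (ε : ℝ) : SemiSet.{u} := (Sing X).sub (IsSmall X ε) IsSmall.face

variable (X) in
/-- The chains of small simplices. -/
noncomputable abbrev smallChains (ε : ℝ) (n : ℕ) : Submodule ℚ ((Sing X).Chains n) :=
  (Sing X).subChains (IsSmall X ε) n

lemma NatOp.sing_mem_small {ε : ℝ} {n k : ℕ} (F : NatOp n k) {c : (Sing X).Chains n}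
    (hc : c ∈ smallChains X ε n) : F.sing X c ∈ smallChains X ε k := by
  refine finsupp_map_mem _ (fun σ hσ => ?_) hc
  have h : F.sing X ((Sing X).of σ) ∈ chainsIn (Set.range σ) k :=
    F.sing_mem_chainsIn (Finsupp.single_mem_supported _ _ (Set.Subset.refl _))
  exact Finsupp.supported_mono (fun τ hτ => hσ.of_range_subset hτ) h

lemma eventually_sdPow_of_mem_small {ε : ℝ} (hε : 0 < ε) {n : ℕ} (σ : (Sing X).S n) :
    ∀ᶠ r in Filter.atTop, ((sdSing X).pow r).f n ((Sing X).of σ) ∈ smallChains X ε n := by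
  obtain ⟨δ, hδ, hσ⟩ := Metric.uniformContinuous_iff.1
    (CompactSpace.uniformContinuous_of_continuous σ.continuous) ε hε
  have hlim : Filter.Tendsto
      (fun r : ℕ => (1 - 1 / (n : ℝ)) ^ r * Metric.diam (Set.univ : Set (Splx n)))
      Filter.atTop (nhds 0) := by
    rcases Nat.eq_zero_or_pos n with rfl | hn
    · have : (Set.univ : Set (Splx 0)) = ∅ := Set.univ_eq_empty_iff.2 inferInstance
      simp [this]
    · have hn' : (1 : ℝ) ≤ n := by exact_mod_cast hn
      have h1 : (1 : ℝ) / n ≤ 1 := by rw [div_le_one (by positivity)]; exact hn'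
      have h2 : (0 : ℝ) < 1 / n := by positivity
      simpa using (tendsto_pow_atTop_nhds_zero_of_lt_one (sub_nonneg.2 h1)
        (sub_lt_self _ h2)).mul_const (Metric.diam (Set.univ : Set (Splx n)))
  filter_upwards [hlim.eventually_lt_const hδ] with r hr
  refine Finsupp.supported_mono ?_ (sdPow_of_mem r σ)
  rintro _ ⟨w, rfl, hw⟩ s t
  refine hσ (lt_of_le_of_lt ?_ hr)
  refine dist_comb_le w s _ fun i => ?_
  rw [dist_comm]
  exact dist_comb_le w t _ fun j => hw j i

lemma eventually_sdPow_mem_small {ε : ℝ} (hε : 0 < ε) {n : ℕ} (c : (Sing X).Chains n) :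
    ∀ᶠ r in Filter.atTop, ((sdSing X).pow r).f n c ∈ smallChains X ε n := by
  induction c using Finsupp.induction_linear with
  | zero => simp
  | add c c' h h' =>
    filter_upwards [h, h'] with r hr hr'
    rw [map_add]
    exact Submodule.add_mem _ hr hr'
  | single σ a =>
    filter_upwards [eventually_sdPow_of_mem_small hε σ] with r hr
    have : Finsupp.single σ a = a • (Sing X).of σ := by simp
    rw [this, map_smul]
    exact Submodule.smul_mem _ _ hr

variable (X) in
/-- The inclusion of the chains of small simplices. -/
noncomputable abbrev smallIncl (ε : ℝ) : Cx.Hom (SmallSing X ε).cx (Sing X).cx :=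
  ((Sing X).subMap (IsSmall X ε) IsSmall.face).hom

lemma smallIncl_mem {ε : ℝ} {n : ℕ} (c : (SmallSing X ε).Chains n) :
    (smallIncl X ε).f n c ∈ smallChains X ε n := subMap_mem c

variable (X) in
/-- The subdivision of small chains. -/
noncomputable def sdSmall (ε : ℝ) : Cx.Hom (SmallSing X ε).cx (SmallSing X ε).cx :=
  lift IsSmall.face ((sdSing X).comp (smallIncl X ε))
    fun _ c => NatOp.sing_mem_small _ (smallIncl_mem c)

lemma smallIncl_sdSmall {ε : ℝ} {n : ℕ} (c : (SmallSing X ε).Chains n) :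
    (smallIncl X ε).f n ((sdSmall X ε).f n c) = (sdSing X).f n ((smallIncl X ε).f n c) :=
  subMap_res (NatOp.sing_mem_small _ (smallIncl_mem c))

lemma smallIncl_sdSmall_pow {ε : ℝ} (r : ℕ) {n : ℕ} (c : (SmallSing X ε).Chains n) :
    (smallIncl X ε).f n (((sdSmall X ε).pow r).f n c)
      = ((sdSing X).pow r).f n ((smallIncl X ε).f n c) := by
  induction r with
  | zero => rfl
  | succ r ih =>
    refine (smallIncl_sdSmall _).trans ?_
    rw [ih]
    rfl

lemma sdSmall_onH {ε : ℝ} (n : ℕ) : (sdSmall X ε).onH n = LinearMap.id := by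
  rw [← Cx.Hom.onH_id]
  refine Cx.Hom.onH_eq_of_homotopy _ _ (fun n => (Sing X).res (IsSmall X ε) IsSmall.face (n + 1) ∘ₗ
    (NatOp.sdHtpy n).sing X ∘ₗ (smallIncl X ε).f n) (fun n c => ?_) n
  have h := congrArg ((Sing X).res (IsSmall X ε) IsSmall.face (n + 1))
    (sdHtpy_spec n ((smallIncl X ε).f (n + 1) c))
  rw [map_sub, map_add, ← bd_res (NatOp.sing_mem_small _ (smallIncl_mem c))] at h
  refine Eq.trans ?_ (h.trans ?_)
  · congr 1
    exact (res_subMap c).symm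
  · rw [(smallIncl X ε).comm n c]
    rfl

/-- The homology of the complex of small chains is the singular homology. -/
lemma smallIncl_onH_bijective {ε : ℝ} (hε : 0 < ε) (n : ℕ) :
    Function.Bijective ((smallIncl X ε).onH n) := by
  constructor
  · rw [injective_iff_map_eq_zero]
    intro x hx
    obtain ⟨z, rfl⟩ := Cx.cls_surjective _ n x
    rw [Cx.Hom.onH_cls, Cx.cls_eq_zero_iff] at hx
    obtain ⟨b, hb⟩ := hx
    obtain ⟨r, hr⟩ := (eventually_sdPow_mem_small hε b).exists
    have h1 : Cx.cls _ n z = ((sdSmall X ε).pow r).onH n (Cx.cls _ n z) := by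
      rw [Cx.Hom.pow_onH (sdSmall_onH n)]
      rfl
    rw [h1, Cx.Hom.onH_cls, Cx.cls_eq_zero_iff]
    refine ⟨(Sing X).res (IsSmall X ε) IsSmall.face _ (((sdSing X).pow r).f _ b), ?_⟩
    refine (bd_res hr).trans ?_
    rw [Cx.Hom.onKer_coe]
    refine (congrArg _ (((sdSing X).pow r).comm _ b)).trans ?_
    rw [hb, Cx.Hom.onKer_coe, ← smallIncl_sdSmall_pow]
    exact res_subMap _
  · intro x
    obtain ⟨z, rfl⟩ := Cx.cls_surjective _ n x
    obtain ⟨r, hr⟩ := (eventually_sdPow_mem_small hε z.1).exists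
    have h1 : Cx.cls _ n z = ((sdSing X).pow r).onH n (Cx.cls _ n z) := by
      rw [Cx.Hom.pow_onH (sdSing_onH n)]
      rfl
    refine ⟨Cx.cls _ n ⟨(Sing X).res (IsSmall X ε) IsSmall.face _ (((sdSing X).pow r).f _ z.1),
      ?_⟩, ?_⟩
    · rw [LinearMap.mem_ker]
      refine (bd_res hr).trans ?_
      refine (congrArg _ (((sdSing X).pow r).comm _ z.1)).trans ?_
      rw [LinearMap.mem_ker.1 z.2, map_zero, map_zero]
    · rw [h1, Cx.Hom.onH_cls, Cx.Hom.onH_cls]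
      congr 1
      exact Subtype.ext (subMap_res hr)

end Small

/-! ### Neighborhood retractions -/

/-- Each point of `X` has an open neighborhood homeomorphic to an open subset of `ℝᵈ`. -/
def LocallyEuclidean (d : ℕ) (X : Type u) [TopologicalSpace X] : Prop :=
  ∀ x : X, ∃ e : OpenPartialHomeomorph X (EuclideanSpace ℝ (Fin d)), x ∈ e.source

section Retraction

variable {X : Type u} [TopologicalSpace X] {E : Type v} [MetricSpace E]

/-- The inductive step in the construction of a neighborhood retraction: the domain of a partial
retraction is enlarged by a neighborhood of a compact subset of a chart domain. -/
lemma extend_retraction [CompactSpace X] {d : ℕ} {ι : X → E} (hι : Continuous ι)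
    (e : OpenPartialHomeomorph X (EuclideanSpace ℝ (Fin d))) {K : Set X} (hK : IsCompact K)
    (hKe : K ⊆ e.source) {N : Set E} (hN : IsClosed N) {r : E → X}
    (hr : ContinuousOn r (Set.range ι ∪ N)) (hrι : ∀ x, r (ι x) = x) :
    ∃ (Z : Set E) (r' : E → X), IsClosed Z ∧ ι '' K ⊆ interior Z ∧
      ContinuousOn r' (Set.range ι ∪ (N ∪ Z)) ∧ ∀ x, r' (ι x) = x := by
  classical
  set A : Set E := Set.range ι ∪ N with hA
  have hAc : IsClosed A := (isCompact_range hι).isClosed.union hN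
  have hKc : IsClosed (ι '' K) := (hK.image hι).isClosed
  obtain ⟨O, hO, hOA⟩ := (continuousOn_iff'.1 hr) e.source e.open_source
  have hKO : ι '' K ⊆ O := by
    rintro _ ⟨x, hx, rfl⟩
    have : ι x ∈ r ⁻¹' e.source ∩ A := ⟨by simpa [hrι] using hKe hx, Or.inl ⟨x, rfl⟩⟩
    rw [hOA] at this
    exact this.1
  obtain ⟨U, hU, hKU, hUO⟩ := normal_exists_closure_subset hKc hO hKO
  -- On `A ∩ closure U` the retraction takes values in the chart domain, so that it can be
  -- extended in the chart by the Tietze extension theorem.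
  have hsrc : ∀ y ∈ A ∩ closure U, r y ∈ e.source := fun y hy =>
    (hOA.symm.subset ⟨hUO hy.2, hy.1⟩ : y ∈ r ⁻¹' e.source ∩ A).1
  have hcont : ContinuousOn (fun y => e (r y)) (A ∩ closure U) :=
    e.continuousOn.comp (hr.mono Set.inter_subset_left) hsrc
  obtain ⟨g, hg⟩ := ContinuousMap.exists_restrict_eq (hAc.inter isClosed_closure)
    (⟨_, continuousOn_iff_continuous_domRestrict.1 hcont⟩ :
      C(↥(A ∩ closure U), EuclideanSpace ℝ (Fin d)))
  have hg' : ∀ y ∈ A ∩ closure U, g y = e (r y) := fun y hy => congr($hg ⟨y, hy⟩)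
  have hKV : ι '' K ⊆ U ∩ g ⁻¹' e.target := by
    rintro _ ⟨x, hx, rfl⟩
    have hxU : ι x ∈ U := hKU ⟨x, hx, rfl⟩
    refine ⟨hxU, ?_⟩
    rw [Set.mem_preimage, hg' _ ⟨Or.inl ⟨x, rfl⟩, subset_closure hxU⟩, hrι]
    exact e.map_source (hKe hx)
  obtain ⟨V, hV, hKV, hVU⟩ := normal_exists_closure_subset hKc
    (hU.inter (e.open_target.preimage g.continuous)) hKV
  set r' : E → X := fun y => if y ∈ A then r y else e.symm (g y) with hr'
  have h1 : Set.EqOn r' r A := fun y hy => if_pos hy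
  have h2 : Set.EqOn r' (fun y => e.symm (g y)) (closure V) := by
    intro y hy
    by_cases hyA : y ∈ A
    · have hyU : y ∈ A ∩ closure U := ⟨hyA, subset_closure (hVU hy).1⟩
      change r' y = e.symm (g y)
      rw [h1 hyA, hg' y hyU, e.left_inv (hsrc y hyU)]
    · exact if_neg hyA
  refine ⟨closure V, r', isClosed_closure,
    hKV.trans (interior_maximal subset_closure hV), ?_, fun x => ?_⟩
  · rw [← Set.union_assoc]
    refine ContinuousOn.union_of_isClosed (hr.congr h1) (ContinuousOn.congr ?_ h2) hAc
      isClosed_closure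
    exact e.continuousOn_symm.comp g.continuous.continuousOn fun y hy => (hVU hy).2
  · rw [h1 (Or.inl ⟨x, rfl⟩), hrι]

/-- A compact locally Euclidean space is a retract of a neighborhood in each metric space that
contains it. -/
lemma exists_nhds_retraction [CompactSpace X] {d : ℕ} (hX : LocallyEuclidean d X) [Nonempty X]
    {ι : X → E} (hι : Continuous ι) (hinj : Function.Injective ι) :
    ∃ (N : Set E) (r : E → X), Set.range ι ⊆ interior N ∧ ContinuousOn r N ∧
      ∀ x, r (ι x) = x := by
  classical
  choose e he using hX
  have hball : ∀ x, ∃ ρ > 0, Metric.closedBall (e x x) ρ ⊆ (e x).target := fun x =>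
    Metric.nhds_basis_closedBall.mem_iff.1 ((e x).open_target.mem_nhds ((e x).map_source (he x)))
  choose ρ hρ hρe using hball
  set K : X → Set X := fun x => (e x).symm '' Metric.closedBall (e x x) (ρ x) with hKdef
  have hK : ∀ x, IsCompact (K x) := fun x => (isCompact_closedBall _ _).image_of_continuousOn
    ((e x).continuousOn_symm.mono (hρe x))
  have hKe : ∀ x, K x ⊆ (e x).source := by
    rintro x _ ⟨y, hy, rfl⟩
    exact (e x).map_target (hρe x hy)
  have hKn : ∀ x, K x ∈ nhds x := by
    intro x
    have h1 : (e x).source ∩ (e x) ⁻¹' Metric.ball (e x x) (ρ x) ∈ nhds x :=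
      ((e x).isOpen_inter_preimage Metric.isOpen_ball).mem_nhds
        ⟨he x, Metric.mem_ball_self (hρ x)⟩
    refine Filter.mem_of_superset h1 ?_
    rintro y ⟨hy, hy'⟩
    exact ⟨e x y, Metric.ball_subset_closedBall hy', (e x).left_inv hy⟩
  obtain ⟨t, -, ht⟩ := isCompact_univ.elim_nhds_subcover K fun x _ => hKn x
  -- The compact chart neighborhoods `K x` are added to the domain of the retraction one by one.
  have key : ∀ s : Finset X, ∃ (N : Set E) (r : E → X), IsClosed N ∧
      (∀ x ∈ s, ι '' K x ⊆ interior N) ∧ ContinuousOn r (Set.range ι ∪ N) ∧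
      ∀ x, r (ι x) = x := by
    intro s
    induction s using Finset.induction_on with
    | empty =>
      refine ⟨∅, Function.invFun ι, isClosed_empty, by simp, ?_,
        Function.leftInverse_invFun hinj⟩
      rw [Set.union_empty, continuousOn_iff_continuous_domRestrict]
      convert! (hι.isClosedEmbedding hinj).isEmbedding.toHomeomorph.symm.continuous using 1
    | insert x s _ ih =>
      obtain ⟨N, r, hN, hs, hr, hrι⟩ := ih
      obtain ⟨Z, r', hZ, hKZ, hr', hrι'⟩ :=
        extend_retraction hι (e x) (hK x) (hKe x) hN hr hrι
      refine ⟨N ∪ Z, r', hN.union hZ, fun y hy => ?_, hr', hrι'⟩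
      rcases Finset.mem_insert.1 hy with rfl | hy
      · exact hKZ.trans (interior_mono Set.subset_union_right)
      · exact (hs y hy).trans (interior_mono Set.subset_union_left)
  obtain ⟨N, r, -, hN, hr, hrι⟩ := key t
  refine ⟨N, r, ?_, hr.mono Set.subset_union_right, hrι⟩
  rintro _ ⟨y, rfl⟩
  obtain ⟨x, hx, hy⟩ := Set.mem_iUnion₂.1 (ht (Set.mem_univ y))
  exact hN x hx ⟨y, hy, rfl⟩

/-- Uniformity of a neighborhood retraction near the compact space. -/
lemma exists_uniform_retraction {X : Type u} [MetricSpace X] [CompactSpace X] {N : Set E}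
    {r : E → X} {ι : X → E} (hι : Continuous ι) (hN : Set.range ι ⊆ interior N)
    (hr : ContinuousOn r N) (hrι : ∀ x, r (ι x) = x) {η : ℝ} (hη : 0 < η) :
    ∃ δ > 0, ∀ x y, dist y (ι x) < δ → y ∈ N ∧ dist (r y) x < η := by
  have hc : ContinuousOn (fun p : E × X => dist (r p.1) p.2) (interior N ×ˢ Set.univ) := by
    have h : ContinuousOn (fun p : E × X => r p.1) (interior N ×ˢ Set.univ) :=
      (hr.mono interior_subset).comp continuousOn_fst fun p hp => hp.1
    exact continuous_dist.comp_continuousOn (h.prodMk continuousOn_snd)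
  have hopen := hc.isOpen_inter_preimage (isOpen_interior.prod isOpen_univ) (isOpen_Iio (a := η))
  have hcomp : IsCompact (Set.range fun x : X => (ι x, x)) :=
    isCompact_range (hι.prodMk continuous_id)
  obtain ⟨δ, hδ, hsub⟩ := hcomp.exists_thickening_subset_open hopen (by
    rintro _ ⟨x, rfl⟩
    refine ⟨⟨hN ⟨x, rfl⟩, trivial⟩, ?_⟩
    simpa [hrι] using hη)
  refine ⟨δ, hδ, fun x y hxy => ?_⟩
  have := hsub (Metric.mem_thickening_iff.2 ⟨(ι x, x), ⟨x, rfl⟩, (by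
    rw [Prod.dist_eq]
    simpa using hxy : dist (y, x) (ι x, x) < δ)⟩)
  exact ⟨interior_subset this.1.1, this.2⟩

end Retraction

/-! ### Clique complexes of relations -/

section Sorted

variable {k : ℕ} (R : Fin k → Fin k → Prop)

/-- Strictly increasing tuples whose entries are pairwise related by `R`. -/
def IsSortedClique (n : ℕ) (v : (Tup (Fin k)).S n) : Prop := StrictMono v ∧ ∀ i j, R (v i) (v j)

lemma IsSortedClique.face (n : ℕ) (i : Fin (n + 1)) (v : (Tup (Fin k)).S (n + 1))
    (h : IsSortedClique R (n + 1) v) : IsSortedClique R n ((Tup (Fin k)).face i v) :=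
  ⟨h.1.comp (Fin.strictMono_succAbove i), fun _ _ => h.2 _ _⟩

/-- The ordered simplicial complex with vertices `Fin k`, in which the simplices are the
cliques of the relation `R`. -/
abbrev CliqueSet : SemiSet.{0} := (Tup (Fin k)).sub (IsSortedClique R) (IsSortedClique.face R)

lemma cliqueSet_isEmpty {n : ℕ} (hn : k < n) : IsEmpty ((CliqueSet R).S n) := by
  refine ⟨fun v => ?_⟩
  have := Fintype.card_le_of_injective _ v.2.1.injective
  simp only [Fintype.card_fin] at this
  omega

instance : Unique ((CliqueSet R).S 0) where
  default := ⟨Fin.elim0, fun i => i.elim0, fun i => i.elim0⟩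
  uniq _ := Subtype.ext (funext fun i => i.elim0)

open Classical in
/-- Adding the vertex `m` at the front of a simplex, if this defines a simplex. -/
noncomputable def cliqueCone (m : Fin k) (n : ℕ) :
    (CliqueSet R).Chains n →ₗ[ℚ] (CliqueSet R).Chains (n + 1) :=
  Finsupp.linearCombination ℚ fun v =>
    if h : IsSortedClique R (n + 1) (Fin.cons m v.1) then (CliqueSet R).of ⟨Fin.cons m v.1, h⟩
    else 0

variable {R}

lemma cliqueCone_of_pos {m : Fin k} {n : ℕ} {v : (CliqueSet R).S n}
    (h : IsSortedClique R (n + 1) (Fin.cons m v.1)) :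
    cliqueCone R m n ((CliqueSet R).of v) = (CliqueSet R).of ⟨Fin.cons m v.1, h⟩ := by
  simp [cliqueCone, h]

lemma cliqueCone_of_neg {m : Fin k} {n : ℕ} {v : (CliqueSet R).S n}
    (h : ¬ IsSortedClique R (n + 1) (Fin.cons m v.1)) :
    cliqueCone R m n ((CliqueSet R).of v) = 0 := by
  simp [cliqueCone, h]

/-- The chains of the simplices with all vertices in `T`. -/
abbrev cliquesIn (R : Fin k → Fin k → Prop) (T : Set (Fin k)) (n : ℕ) :
    Submodule ℚ ((CliqueSet R).Chains n) :=
  Finsupp.supported ℚ ℚ {v | ∀ i, v.1 i ∈ T}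

lemma isSortedClique_cons {T : Set (Fin k)} (hT : ∀ a ∈ T, ∀ b ∈ T, R a b) {m : Fin k}
    (hm : m ∈ T) {n : ℕ} {v : (CliqueSet R).S n} (hv : ∀ i, v.1 i ∈ T) (h : ∀ i, m < v.1 i) :
    IsSortedClique R (n + 1) (Fin.cons m v.1) := by
  have hmem : ∀ i, (Fin.cons m v.1 : Fin (n + 1) → Fin k) i ∈ T := by
    intro i
    refine Fin.cases ?_ (fun i => ?_) i
    · simpa using hm
    · simpa using hv i
  refine ⟨?_, fun i j => hT _ (hmem i) _ (hmem j)⟩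
  intro i j
  refine Fin.cases ?_ (fun i => ?_) i <;> refine Fin.cases ?_ (fun j => ?_) j
  · simp
  · simpa using h j
  · simp
  · simpa using fun hij => v.2.1 hij

lemma cliqueCone_mem {T : Set (Fin k)} {m : Fin k} (hm : m ∈ T) {n : ℕ}
    {c : (CliqueSet R).Chains n} (hc : c ∈ cliquesIn R T n) :
    cliqueCone R m n c ∈ cliquesIn R T (n + 1) := by
  refine finsupp_map_mem _ (fun v hv => ?_) hc
  by_cases h : IsSortedClique R (n + 1) (Fin.cons m v.1)
  · rw [cliqueCone_of_pos h]
    refine Finsupp.single_mem_supported _ _ fun i => ?_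
    refine Fin.cases ?_ (fun i => ?_) i
    · simpa using hm
    · simpa using hv i
  · rw [cliqueCone_of_neg h]
    exact Submodule.zero_mem _

lemma bd_cliqueCone_zero {T : Set (Fin k)} (hT : ∀ a ∈ T, ∀ b ∈ T, R a b) {m : Fin k}
    (hm : m ∈ T) (c : (CliqueSet R).Chains 0) :
    (CliqueSet R).bd 0 (cliqueCone R m 0 c) = c := by
  suffices h : (CliqueSet R).bd 0 ∘ₗ cliqueCone R m 0 = LinearMap.id from congr($h c)
  refine finsupp_hom_ext fun v => ?_
  have hv : IsSortedClique R 1 (Fin.cons m v.1) :=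
    isSortedClique_cons hT hm (fun i => i.elim0) fun i => i.elim0
  rw [LinearMap.comp_apply, cliqueCone_of_pos hv, bd_of]
  rw [Fin.sum_univ_succ, Subsingleton.elim ((CliqueSet R).face 0 _) v]
  simp

/-- Coning off from the least element of `T` contracts the full subcomplex with vertices `T`. -/
lemma bd_cliqueCone {T : Set (Fin k)} (hT : ∀ a ∈ T, ∀ b ∈ T, R a b) {m : Fin k}
    (hm : IsLeast T m) (n : ℕ) {c : (CliqueSet R).Chains (n + 1)}
    (hc : c ∈ cliquesIn R T (n + 1)) :
    (CliqueSet R).bd (n + 1) (cliqueCone R m (n + 1) c)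
      = c - cliqueCone R m n ((CliqueSet R).bd n c) := by
  refine finsupp_map_eq ((CliqueSet R).bd (n + 1) ∘ₗ cliqueCone R m (n + 1))
    (LinearMap.id - cliqueCone R m n ∘ₗ (CliqueSet R).bd n) (fun v hv => ?_) hc
  rw [LinearMap.sub_apply, LinearMap.comp_apply, LinearMap.comp_apply, bd_of, map_sum,
    LinearMap.id_apply]
  simp only [map_smul]
  rcases (hm.2 (hv 0)).eq_or_lt with h0 | h0
  · have hneg : ¬ IsSortedClique R (n + 2) (Fin.cons m v.1) := by
      intro h
      have := h.1 (show (0 : Fin (n + 2)) < (0 : Fin (n + 1)).succ from Fin.succ_pos _)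
      rw [Fin.cons_zero, Fin.cons_succ, ← h0] at this
      exact lt_irrefl _ this
    have hface : (Fin.cons m ((CliqueSet R).face 0 v).1 : Fin (n + 1) → Fin k) = v.1 := by
      ext1 i
      refine Fin.cases ?_ (fun i => ?_) i <;> simp [h0]
    have h1 : IsSortedClique R (n + 1) (Fin.cons m ((CliqueSet R).face 0 v).1) := hface ▸ v.2
    rw [cliqueCone_of_neg hneg, map_zero, Fin.sum_univ_succ, cliqueCone_of_pos h1,
      Finset.sum_eq_zero]
    · have : (⟨Fin.cons m ((CliqueSet R).face 0 v).1, h1⟩ : (CliqueSet R).S (n + 1)) = v :=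
        Subtype.ext hface
      rw [this]
      simp
    · intro i _
      rw [cliqueCone_of_neg, smul_zero]
      intro h
      obtain ⟨n, rfl⟩ : ∃ l, n = l + 1 := Nat.exists_eq_succ_of_ne_zero (Fin.pos i).ne'
      have := h.1 (show (0 : Fin (n + 2)) < (0 : Fin (n + 1)).succ from Fin.succ_pos _)
      rw [Fin.cons_zero, Fin.cons_succ] at this
      simp [h0] at this
  · have hlt : ∀ i, m < v.1 i := fun i => h0.trans_le (v.2.1.monotone (Fin.zero_le i))
    have hpos : IsSortedClique R (n + 2) (Fin.cons m v.1) := isSortedClique_cons hT hm.1 hv hlt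
    rw [cliqueCone_of_pos hpos, bd_of, Fin.sum_univ_succ, sub_eq_add_neg, ← Finset.sum_neg_distrib]
    congr 1
    · simp
    · refine Finset.sum_congr rfl fun i _ => ?_
      have hi := cliqueCone_of_pos (v := (CliqueSet R).face i v)
        (isSortedClique_cons hT hm.1 (fun j => hv _) fun j => hlt _)
      refine Eq.trans ?_ (congrArg (fun c => -((-1 : ℚ) ^ (i : ℕ) • c)) hi).symm
      rw [Fin.val_succ, pow_succ, mul_neg_one, neg_smul]
      congr 3
      apply Subtype.ext
      ext1 j
      refine Fin.cases ?_ (fun j => ?_) j <;> simp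

end Sorted

/-! ### Finite models of compact locally Euclidean spaces -/

lemma range_face_subset {X : Type u} [TopologicalSpace X] {n : ℕ} (i : Fin (n + 1))
    (σ : (Sing X).S (n + 1)) : Set.range ((Sing X).face i σ) ⊆ Set.range σ := by
  rintro _ ⟨t, rfl⟩
  exact ⟨faceIncl i t, rfl⟩

section Push

variable {X : Type u} [TopologicalSpace X] {E : Type v} [TopologicalSpace E] {r : E → X} {N : Set E}

open Classical in
/-- Composition of the singular simplices with a partially continuous map `r`; the simplices whose
composition with `r` is not continuous are dropped. -/
noncomputable def retrLin (r : E → X) (n : ℕ) : (Sing E).Chains n →ₗ[ℚ] (Sing X).Chains n :=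
  Finsupp.linearCombination ℚ fun σ =>
    if h : Continuous (r ∘ σ) then (Sing X).of ⟨r ∘ σ, h⟩ else 0

lemma continuous_comp_of_range_subset (hr : ContinuousOn r N) {n : ℕ} {σ : (Sing E).S n}
    (hσ : Set.range σ ⊆ N) : Continuous (r ∘ σ) :=
  hr.comp_continuous σ.continuous fun t => hσ ⟨t, rfl⟩

lemma retrLin_of {n : ℕ} {σ : (Sing E).S n} (h : Continuous (r ∘ σ)) :
    retrLin r n ((Sing E).of σ) = (Sing X).of ⟨r ∘ σ, h⟩ := by
  simp [retrLin, h]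

lemma bd_retrLin (hr : ContinuousOn r N) (n : ℕ) {c : (Sing E).Chains (n + 1)}
    (hc : c ∈ chainsIn N (n + 1)) :
    (Sing X).bd n (retrLin r (n + 1) c) = retrLin r n ((Sing E).bd n c) := by
  refine finsupp_map_eq ((Sing X).bd n ∘ₗ retrLin r (n + 1)) (retrLin r n ∘ₗ (Sing E).bd n)
    (fun σ hσ => ?_) hc
  rw [LinearMap.comp_apply, LinearMap.comp_apply,
    retrLin_of (continuous_comp_of_range_subset hr hσ), bd_of, bd_of, map_sum]
  refine Finset.sum_congr rfl fun i _ => ?_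
  have hi : Set.range ((Sing E).face i σ) ⊆ N := (range_face_subset i σ).trans hσ
  rw [map_smul]
  exact congrArg _ (retrLin_of (continuous_comp_of_range_subset hr hi)).symm

lemma retrLin_singMap {ι : C(X, E)} (hι : ∀ x, r (ι x) = x) (n : ℕ) (c : (Sing X).Chains n) :
    retrLin r n ((singMap ι).lin n c) = c := by
  suffices h : retrLin r n ∘ₗ (singMap ι).lin n = LinearMap.id from congr($h c)
  refine finsupp_hom_ext fun σ => ?_
  have h : r ∘ (ι.comp σ) = σ := funext fun t => hι (σ t)
  rw [LinearMap.comp_apply, Map.lin_of]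
  refine (retrLin_of (σ := ι.comp σ) (by rw [h]; exact σ.continuous)).trans ?_
  rw [LinearMap.id_apply]
  congr 1
  ext1 t
  exact hι (σ t)

/-- The composition of a chain map with a partially continuous map. -/
noncomputable def push {C : Cx.{w}} (γ : Cx.Hom C (Sing E).cx) (hr : ContinuousOn r N)
    (hγ : ∀ n x, γ.f n x ∈ chainsIn N n) : Cx.Hom C (Sing X).cx where
  f n := retrLin r n ∘ₗ γ.f n
  comm n x := by
    rw [LinearMap.comp_apply, LinearMap.comp_apply, ← γ.comm]
    exact bd_retrLin hr n (hγ _ x)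

end Push

instance (X : Type u) [TopologicalSpace X] : Subsingleton (C(Splx 0, X)) :=
  ⟨fun _ _ => ContinuousMap.ext fun t => isEmptyElim t⟩

/-- A finite simplicial complex `L` that approximates the space `X` up to the distance `η`: the
singular chains of `X` are a homotopy retract of the chains of `L`, by chain maps that move points
by less than `η`. The simplices of `L` have at most `k` vertices, whose positions in `X` are given
by `q`. The map `α` is defined on the singular simplices of diameter less than `ε`, and `α`, `β`
preserve the empty simplex. -/
structure FiniteModel (X : Type u) [MetricSpace X] (η : ℝ) where
  L : SemiSet.{0}
  k : ℕ
  finite : ∀ n, Finite (L.S n)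
  empty : ∀ n, k < n → IsEmpty (L.S n)
  unique : Unique (L.S 0)
  nonempty : Nonempty (L.S 1)
  q : ∀ {n}, L.S n → Fin n → X
  ε : ℝ
  ε_pos : 0 < ε
  α : Cx.Hom (SmallSing X ε).cx L.cx
  β : Cx.Hom L.cx (Sing X).cx
  α_mem : ∀ {n} (σ : (SmallSing X ε).S n), α.f n ((SmallSing X ε).of σ) ∈
    Finsupp.supported ℚ ℚ {v | ∀ i, ∃ t, dist (q v i) (σ.1 t) < η}
  β_mem : ∀ {n} (v : L.S n), β.f n (L.of v) ∈ chainsIn {x | ∀ i, dist x (q v i) < η} n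
  α_zero : ∀ σ v, α.f 0 ((SmallSing X ε).of σ) = L.of v
  β_zero : ∀ v σ, β.f 0 (L.of v) = (Sing X).of σ
  β_α : ∀ n, β.onH n ∘ₗ α.onH n = (smallIncl X ε).onH n

section Model

variable {X : Type u} [MetricSpace X] {k : ℕ} {c : Fin k → X} {π : X → Fin k} {ε : ℝ}

/-- The relation of being at distance less than `3 ε`. -/
def NearRel (c : Fin k → X) (ε : ℝ) (i j : Fin k) : Prop := dist (c i) (c j) < 3 * ε

/-- The vertices of the approximation of a small singular simplex. -/
def vertSet (π : X → Fin k) {n : ℕ} (σ : (SmallSing X ε).S n) : Set (Fin k) :=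
  Set.range fun i => π (σ.1 (stdSimplex.vertex i))

lemma vertSet_face {n : ℕ} (i : Fin (n + 1)) (σ : (SmallSing X ε).S (n + 1)) :
    vertSet π ((SmallSing X ε).face i σ) ⊆ vertSet π σ := by
  rintro _ ⟨j, rfl⟩
  refine ⟨i.succAbove j, ?_⟩
  exact congrArg (fun x => π (σ.1 x)) (faceIncl_vertex i j).symm

lemma nearRel_of_mem_vertSet (hπ : ∀ x, dist (c (π x)) x < ε) {n : ℕ} (σ : (SmallSing X ε).S n) :
    ∀ a ∈ vertSet π σ, ∀ b ∈ vertSet π σ, NearRel c ε a b := by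
  rintro _ ⟨i, rfl⟩ _ ⟨j, rfl⟩
  have h1 := hπ (σ.1 (stdSimplex.vertex i))
  have h2 := hπ (σ.1 (stdSimplex.vertex j))
  have h3 := σ.2 (stdSimplex.vertex i) (stdSimplex.vertex j)
  have h4 := dist_triangle4_right (c (π (σ.1 (stdSimplex.vertex i))))
    (c (π (σ.1 (stdSimplex.vertex j)))) (σ.1 (stdSimplex.vertex i)) (σ.1 (stdSimplex.vertex j))
  unfold NearRel
  linarith

/-- The least vertex of the approximation of a small singular simplex. -/
noncomputable def minVert (π : X → Fin k) {n : ℕ} (σ : (SmallSing X ε).S (n + 1)) : Fin k :=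
  Finset.univ.inf' Finset.univ_nonempty fun i => π (σ.1 (stdSimplex.vertex i))

lemma isLeast_minVert {n : ℕ} (σ : (SmallSing X ε).S (n + 1)) :
    IsLeast (vertSet π σ) (minVert π σ) := by
  constructor
  · obtain ⟨i, -, hi⟩ := Finset.exists_mem_eq_inf' (s := Finset.univ) Finset.univ_nonempty
      fun i => π (σ.1 (stdSimplex.vertex i))
    exact ⟨i, hi.symm⟩
  · rintro _ ⟨i, rfl⟩
    exact Finset.inf'_le _ (Finset.mem_univ i)

/-- The carriers of the approximation of small singular simplices. -/
noncomputable def approxCarrier (hπ : ∀ x, dist (c (π x)) x < ε) :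
    Carrier (SmallSing X ε) (CliqueSet (NearRel c ε)).cx where
  A σ m := cliquesIn (NearRel c ε) (vertSet π σ) m
  mono i σ _ := Finsupp.supported_mono fun _ hv j => vertSet_face i σ (hv j)
  cone σ m := cliqueCone (NearRel c ε) (minVert π σ) m
  cone_mem σ _ _ hx := cliqueCone_mem (isLeast_minVert σ).1 hx
  d_cone σ m _ hx := bd_cliqueCone (nearRel_of_mem_vertSet hπ σ) (isLeast_minVert σ) m hx
  d_cone_zero σ _ _ := bd_cliqueCone_zero (nearRel_of_mem_vertSet hπ σ) (isLeast_minVert σ).1 _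

/-- The map that sends all the empty simplices to the empty simplex. -/
noncomputable def emptyMap (K : SemiSet.{u}) (L : SemiSet.{v}) [Inhabited (L.S 0)] :
    K.Chains 0 →ₗ[ℚ] L.Chains 0 :=
  Finsupp.linearCombination ℚ fun _ => L.of default

lemma emptyMap_of (K : SemiSet.{u}) (L : SemiSet.{v}) [Inhabited (L.S 0)] (x : K.S 0) :
    emptyMap K L (K.of x) = L.of default := by
  simp [emptyMap]

lemma emptyMap_mem (hπ : ∀ x, dist (c (π x)) x < ε) (σ : (SmallSing X ε).S 0) :
    emptyMap (SmallSing X ε) (CliqueSet (NearRel c ε)) ((SmallSing X ε).of σ)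
      ∈ (approxCarrier hπ).A σ 0 := by
  rw [emptyMap_of]
  exact Finsupp.single_mem_supported _ _ fun i => i.elim0

/-- The approximation of small singular chains by simplicial chains. -/
noncomputable def approx (hπ : ∀ x, dist (c (π x)) x < ε) :
    Cx.Hom (SmallSing X ε).cx (CliqueSet (NearRel c ε)).cx :=
  (approxCarrier hπ).extend (emptyMap _ _) (emptyMap_mem hπ)

lemma approx_mem (hπ : ∀ x, dist (c (π x)) x < ε) {n : ℕ} (σ : (SmallSing X ε).S n) :
    (approx hπ).f n ((SmallSing X ε).of σ) ∈ cliquesIn (NearRel c ε) (vertSet π σ) n :=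
  (approxCarrier hπ).extendFun_mem (emptyMap_mem hπ) n σ

variable {E : Type v} [NormedAddCommGroup E] [NormedSpace ℝ E] (ι : C(X, E))

variable (c ε) in
/-- The realization of simplicial chains by affine simplices. -/
noncomputable def realize : Cx.Hom (CliqueSet (NearRel c ε)).cx (Sing E).cx :=
  (affMap E).hom.comp ((tupMap (ι ∘ c)).hom.comp
    ((Tup (Fin k)).subMap (IsSortedClique (NearRel c ε)) (IsSortedClique.face _)).hom)

lemma realize_of {n : ℕ} (v : (CliqueSet (NearRel c ε)).S n) :
    (realize c ε ι).f n ((CliqueSet (NearRel c ε)).of v)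
      = (Sing E).of ((affMap E).app n (ι ∘ c ∘ v.1)) := by
  change (affMap E).lin n ((tupMap (ι ∘ c)).lin n (Map.lin _ n _)) = _
  rw [Map.lin_of, Map.lin_of, Map.lin_of]
  rfl

lemma realize_of_mem {B : Set E} (hB : Convex ℝ B) {n : ℕ} (v : (CliqueSet (NearRel c ε)).S n)
    (hv : ∀ i, ι (c (v.1 i)) ∈ B) :
    (realize c ε ι).f n ((CliqueSet (NearRel c ε)).of v) ∈ chainsIn B n := by
  rw [realize_of]
  exact Finsupp.single_mem_supported _ _ (affMap_range_subset hB hv)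

/-- The convex hull of a small singular simplex and the vertices of its approximation. -/
def hull (c : Fin k → X) (π : X → Fin k) {n : ℕ} (σ : (SmallSing X ε).S n) : Set E :=
  convexHull ℝ (ι '' (Set.range σ.1 ∪ c '' vertSet π σ))

lemma hull_face {n : ℕ} (i : Fin (n + 1)) (σ : (SmallSing X ε).S (n + 1)) :
    hull ι c π ((SmallSing X ε).face i σ) ⊆ hull ι c π σ :=
  convexHull_mono (Set.image_mono (Set.union_subset_union (range_face_subset i σ.1)
    (Set.image_mono (vertSet_face i σ))))

lemma hull_subset_ball (hι : Isometry ι) (hπ : ∀ x, dist (c (π x)) x < ε) {n : ℕ}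
    (σ : (SmallSing X ε).S n) (t : Splx n) : hull ι c π σ ⊆ Metric.ball (ι (σ.1 t)) (2 * ε) := by
  refine convexHull_min ?_ (convex_ball _ _)
  have hε : 0 < ε := dist_nonneg.trans_lt (hπ (σ.1 t))
  rintro _ ⟨x, ⟨s, rfl⟩ | ⟨_, ⟨i, rfl⟩, rfl⟩, rfl⟩
  · rw [Metric.mem_ball, hι.dist_eq]
    linarith [σ.2 s t]
  · rw [Metric.mem_ball, hι.dist_eq]
    linarith [σ.2 (stdSimplex.vertex i) t, hπ (σ.1 (stdSimplex.vertex i)),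
      dist_triangle (c (π (σ.1 (stdSimplex.vertex i)))) (σ.1 (stdSimplex.vertex i)) (σ.1 t)]

/-- The carriers for the comparison of a small singular simplex with its approximation. -/
noncomputable def hullCarrier (c : Fin k → X) (π : X → Fin k) (ε : ℝ) :
    Carrier (SmallSing X ε) (Sing E).cx where
  A σ m := chainsIn (hull ι c π σ) m
  mono i σ m := chainsIn_mono (hull_face ι i σ) m
  cone σ m := coneLin (K := Sing E) (singCone (ι (σ.1 (stdSimplex.vertex 0)))) m
  cone_mem σ m x hx := by
    refine finsupp_map_mem _ (fun τ hτ => ?_) hx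
    rw [coneLin_of]
    refine Finsupp.single_mem_supported _ _ (singCone_range_subset (convex_convexHull _ _) ?_ hτ)
    exact subset_convexHull _ _ ⟨_, Or.inl ⟨_, rfl⟩, rfl⟩
  d_cone _ m x _ := bd_coneLin (face_zero_singCone _) (face_succ_singCone _) m x
  d_cone_zero _ x _ := bd_coneLin_zero (face_zero_singCone _) x

lemma realize_approx_mem (hπ : ∀ x, dist (c (π x)) x < ε) {n : ℕ} (σ : (SmallSing X ε).S n) :
    (realize c ε ι).f n ((approx hπ).f n ((SmallSing X ε).of σ)) ∈ chainsIn (hull ι c π σ) n := by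
  refine finsupp_map_mem ((realize c ε ι).f n) (fun v hv => ?_) (approx_mem hπ σ)
  exact realize_of_mem ι (convex_convexHull _ _) v fun i =>
    subset_convexHull _ _ ⟨_, Or.inr ⟨_, hv i, rfl⟩, rfl⟩

lemma singMap_smallIncl_mem {n : ℕ} (σ : (SmallSing X ε).S n) :
    (singMap ι).lin n ((smallIncl X ε).f n ((SmallSing X ε).of σ))
      ∈ chainsIn (hull ι c π σ) n := by
  have h : (smallIncl X ε).f n ((SmallSing X ε).of σ) = (Sing X).of σ.1 := Map.lin_of _ _
  rw [h, Map.lin_of]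
  refine Finsupp.single_mem_supported _ _ ?_
  rintro _ ⟨t, rfl⟩
  exact subset_convexHull _ _ ⟨_, Or.inl ⟨t, rfl⟩, rfl⟩

end Model

/-- A compact locally Euclidean space has arbitrarily fine finite models. -/
theorem exists_finiteModel {X : Type u} [MetricSpace X] [CompactSpace X] [Nonempty X] {d : ℕ}
    (hX : LocallyEuclidean d X) {η : ℝ} (hη : 0 < η) : Nonempty (FiniteModel X η) := by
  have hι := kuratowskiEmbedding.isometry X
  set ι : C(X, lp (fun _ : ℕ => ℝ) ⊤) := ⟨kuratowskiEmbedding X, hι.continuous⟩ with hιdef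
  replace hι : Isometry ι := hι
  obtain ⟨N, r, hN, hr, hrι⟩ := exists_nhds_retraction hX ι.continuous hι.injective
  obtain ⟨δ, hδ, hδN⟩ := exists_uniform_retraction ι.continuous hN hr hrι hη
  obtain ⟨ε, hε, hεδ, hεη⟩ : ∃ ε > 0, 3 * ε ≤ δ ∧ ε ≤ η :=
    ⟨min (δ / 3) η, by positivity, by linarith [min_le_left (δ / 3) η], min_le_right _ _⟩
  obtain ⟨t, -, htfin, ht⟩ := finite_cover_balls_of_compact (isCompact_univ (X := X)) hε
  obtain ⟨k, c, -, hc⟩ := htfin.fin_param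
  have hπ : ∀ x, ∃ i, dist (c i) x < ε := by
    intro x
    obtain ⟨y, hy, hxy⟩ := Set.mem_iUnion₂.1 (ht (Set.mem_univ x))
    obtain ⟨i, rfl⟩ : y ∈ Set.range c := hc ▸ hy
    exact ⟨i, by rw [dist_comm]; exact hxy⟩
  choose π hπ using hπ
  -- The vertices of a simplex are at distance less than `3 ε ≤ δ`, so that its affine realization
  -- lies in the domain of the retraction.
  have hreal : ∀ n (v : (CliqueSet (NearRel c ε)).S n),
      (realize c ε ι).f n ((CliqueSet (NearRel c ε)).of v) ∈
        chainsIn {y | ∀ i, dist y (ι (c (v.1 i))) < δ} n := by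
    intro n v
    have hconv : {y | ∀ i, dist y (ι (c (v.1 i))) < δ}
        = ⋂ i, Metric.ball (ι (c (v.1 i))) δ := by
      ext y
      simp
    refine realize_of_mem ι ?_ v fun j i => ?_
    · rw [hconv]
      exact convex_iInter fun i => convex_ball _ _
    · rw [hι.dist_eq]
      exact (v.2.2 j i).trans_le hεδ
  have hrange : ∀ n (v : (CliqueSet (NearRel c ε)).S n) (σ : (Sing _).S n),
      Set.range σ ⊆ {y | ∀ i, dist y (ι (c (v.1 i))) < δ} → Set.range σ ⊆ N := by
    rintro n v σ hσ _ ⟨s, rfl⟩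
    cases n with
    | zero => exact isEmptyElim s
    | succ n => exact (hδN _ _ (hσ ⟨s, rfl⟩ 0)).1
  have hrealN : ∀ n x, (realize c ε ι).f n x ∈ chainsIn N n := by
    intro n x
    refine finsupp_map_mem (A := Set.univ) ((realize c ε ι).f n) (fun v _ => ?_) (by simp)
    exact Finsupp.supported_mono (fun σ hσ => hrange n v σ hσ) (hreal n v)
  have hhull : ∀ n (σ : (SmallSing X ε).S n), hull ι c π σ ⊆ N := by
    intro n σ
    cases n with
    | zero =>
      have h1 : Set.range σ.1 = ∅ := Set.range_eq_empty _
      have h2 : vertSet π σ = ∅ := Set.range_eq_empty _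
      simp [hull, h1, h2]
    | succ n =>
      intro y hy
      have := hull_subset_ball ι hι hπ σ (stdSimplex.vertex 0) hy
      exact (hδN _ _ (this.trans_le (by linarith))).1
  have happrox : ∀ (σ : (SmallSing X ε).S 0) v, (approx hπ).f 0 ((SmallSing X ε).of σ)
      = (CliqueSet (NearRel c ε)).of v := by
    intro σ v
    rw [Subsingleton.elim v default]
    exact emptyMap_of _ _ _
  -- Realization after approximation is homotopic to the inclusion in the Banach space, within the
  -- convex hulls `hull ι c π σ`, to which the retraction applies.
  let f := (realize c ε ι).comp (approx hπ)
  let g := (singMap ι).hom.comp (smallIncl X ε)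
  have hf : ∀ n σ, f.f n ((SmallSing X ε).of σ) ∈ (hullCarrier ι c π ε).A σ n :=
    fun n σ => realize_approx_mem ι hπ σ
  have hg : ∀ n σ, g.f n ((SmallSing X ε).of σ) ∈ (hullCarrier ι c π ε).A σ n :=
    fun n σ => singMap_smallIncl_mem ι σ
  have h0 : f.f 0 = g.f 0 := by
    refine finsupp_hom_ext fun σ => ?_
    change (realize c ε ι).f 0 ((approx hπ).f 0 _) = (singMap ι).lin 0 (Map.lin _ 0 _)
    rw [happrox σ default, realize_of, Map.lin_of, Map.lin_of]
    congr 1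
    exact Subsingleton.elim _ _
  have hmem : ∀ n x, (hullCarrier ι c π ε).homotopyFun f g n x ∈ chainsIn N (n + 1) := by
    intro n x
    refine finsupp_map_mem (A := Set.univ) ((hullCarrier ι c π ε).homotopyFun f g n)
      (fun σ _ => ?_) (by simp)
    exact chainsIn_mono (hhull n σ) _ ((hullCarrier ι c π ε).homotopyFun_mem hf hg n σ)
  refine ⟨⟨CliqueSet (NearRel c ε), k, fun n => inferInstance, fun n hn => cliqueSet_isEmpty _ hn,
    inferInstance, ?_, fun v i => c (v.1 i), ε, hε, approx hπ, push (realize c ε ι) hr hrealN,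
    ?_, ?_, happrox, ?_, ?_⟩⟩
  · obtain ⟨x⟩ := ‹Nonempty X›
    refine ⟨⟨fun _ => π x, Subsingleton.strictMono _, fun i j => ?_⟩⟩
    unfold NearRel
    rw [dist_self]
    positivity
  · intro n σ
    refine Finsupp.supported_mono (fun v hv i => ?_) (approx_mem hπ σ)
    obtain ⟨j, hj⟩ := hv i
    refine ⟨stdSimplex.vertex j, ?_⟩
    rw [← hj]
    exact (hπ _).trans_le hεη
  · intro n v
    refine finsupp_map_mem (retrLin r n) (fun σ hσ => ?_) (hreal n v)
    rw [retrLin_of (continuous_comp_of_range_subset hr (hrange n v σ hσ))]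
    refine Finsupp.single_mem_supported _ _ ?_
    rintro _ ⟨s, rfl⟩ i
    exact (hδN _ _ (hσ ⟨s, rfl⟩ i)).2
  · intro v σ
    change retrLin r 0 ((realize c ε ι).f 0 _) = _
    rw [realize_of, retrLin_of (continuous_of_const fun s => isEmptyElim s)]
    congr 1
    exact Subsingleton.elim _ _
  · intro n
    rw [← Cx.Hom.onH_comp]
    refine Cx.Hom.onH_eq_of_homotopy _ _
      (fun n => retrLin r (n + 1) ∘ₗ (hullCarrier ι c π ε).homotopyFun f g n) (fun n x => ?_) n
    have hspec := (hullCarrier ι c π ε).homotopyFun_spec hf hg h0 n x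
    have hx := retrLin_singMap (ι := ι) hrι (n + 1) ((smallIncl X ε).f (n + 1) x)
    have hspec' := congrArg (retrLin r (n + 1)) hspec
    rw [map_sub, map_add] at hspec'
    refine Eq.trans ?_ (hspec'.trans ?_)
    · exact congrArg _ hx.symm
    · congr 1
      exact (bd_retrLin hr (n + 1) (hmem (n + 1) x)).symm

/-! ### The Lefschetz number of a map without fixed points -/

lemma trace_finsupp {S : Type*} [Fintype S] (φ : (S →₀ ℚ) →ₗ[ℚ] (S →₀ ℚ)) :
    LinearMap.trace ℚ _ φ = ∑ v, φ (Finsupp.single v 1) v := by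
  classical
  rw [LinearMap.trace_eq_matrix_trace ℚ Finsupp.basisSingleOne, Matrix.trace]
  refine Finset.sum_congr rfl fun v _ => ?_
  rw [Matrix.diag_apply, LinearMap.toMatrix_apply]
  simp

lemma sdPow_zero {X : Type u} [TopologicalSpace X] (r : ℕ) (c : (Sing X).Chains 0) :
    ((sdSing X).pow r).f 0 c = c := by
  induction r with
  | zero => rfl
  | succ r ih => exact (NatOp.sing_id 0 _).trans ih

namespace FiniteModel

variable {X : Type u} [MetricSpace X] {η : ℝ} (M : FiniteModel X η)

instance (n : ℕ) : FiniteDimensional ℚ (M.L.Chains n) :=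
  have := M.finite n
  inferInstance

lemma subsingleton_chains {n : ℕ} (hn : M.k < n) : Subsingleton (M.L.Chains n) :=
  have := M.empty n hn
  inferInstance

/-- The isomorphism from the homology of small chains to singular homology. -/
noncomputable def smallEquiv (n : ℕ) : (SmallSing X M.ε).cx.H n ≃ₗ[ℚ] (Sing X).cx.H n :=
  LinearEquiv.ofBijective ((smallIncl X M.ε).onH n) (smallIncl_onH_bijective M.ε_pos n)

/-- The map from the homology of a space to that of a finite model. -/
noncomputable def toModel (n : ℕ) : (Sing X).cx.H n →ₗ[ℚ] M.L.cx.H n :=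
  M.α.onH n ∘ₗ (M.smallEquiv n).symm

lemma β_toModel (n : ℕ) : M.β.onH n ∘ₗ M.toModel n = LinearMap.id := by
  rw [toModel, ← LinearMap.comp_assoc, M.β_α]
  refine LinearMap.ext fun x => ?_
  exact (M.smallEquiv n).apply_symm_apply x

lemma toModel_injective (n : ℕ) : Function.Injective (M.toModel n) :=
  Function.LeftInverse.injective (g := M.β.onH n) fun x => congr($(M.β_toModel n) x)

lemma finiteDimensional_H (M : FiniteModel X η) (n : ℕ) :
    FiniteDimensional ℚ ((Sing X).cx.H n) :=
  FiniteDimensional.of_injective _ (M.toModel_injective n)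

lemma subsingleton_H {n : ℕ} (hn : M.k ≤ n) : Subsingleton ((Sing X).cx.H n) := by
  have := M.subsingleton_chains (Nat.lt_succ_of_le hn)
  have : Subsingleton (M.L.cx.H n) := (M.L.cx.cls_surjective n).subsingleton
  exact (M.toModel_injective n).subsingleton

variable (f : C(X, X))

/-- The composition of the realization of a finite model with a self-map of the space. -/
noncomputable def mapβ : Cx.Hom M.L.cx (Sing X).cx := (singMap f).hom.comp M.β

lemma mapβ_mem {n : ℕ} (v : M.L.S n) : (M.mapβ f).f n (M.L.of v) ∈
    chainsIn {y | ∃ x, f x = y ∧ ∀ i, dist x (M.q v i) < η} n := by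
  refine finsupp_map_mem ((singMap f).lin n) (fun σ hσ => ?_) (M.β_mem v)
  rw [Map.lin_of]
  refine Finsupp.single_mem_supported _ _ ?_
  rintro _ ⟨t, rfl⟩
  exact ⟨σ t, rfl, hσ ⟨t, rfl⟩⟩

/-- As the model is finite, one number of subdivisions makes the images of all simplices small. -/
lemma exists_sdPow : ∃ s, ∀ n x, (((sdSing X).pow s).comp (M.mapβ f)).f n x
    ∈ smallChains X M.ε n := by
  have := M.finite
  have h : ∀ᶠ s in Filter.atTop, ∀ p : Σ n : Fin (M.k + 1), M.L.S n,
      ((sdSing X).pow s).f p.1 ((M.mapβ f).f p.1 (M.L.of p.2)) ∈ smallChains X M.ε p.1 :=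
    Filter.eventually_all.2 fun p => eventually_sdPow_mem_small M.ε_pos _
  obtain ⟨s, hs⟩ := h.exists
  refine ⟨s, fun n x => ?_⟩
  refine finsupp_map_mem (A := Set.univ) ((((sdSing X).pow s).comp (M.mapβ f)).f n)
    (fun v _ => ?_) (by simp)
  rcases lt_or_ge M.k n with hn | hn
  · exact ((M.empty n hn).false v).elim
  · exact hs ⟨⟨n, Nat.lt_succ_of_le hn⟩, v⟩

/-- The Lefschetz number, in terms of reduced homology, of a map that moves all points sufficiently
far: the induced map of a fine finite model moves each simplex off itself, so that its traces on
chains vanish. -/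
theorem sum_trace_eq_neg_one (hf : ∀ x, 2 * η ≤ dist (f x) x) {K : ℕ} (hK : M.k < K) :
    ∑ n ∈ Finset.range K, (-1 : ℚ) ^ n * LinearMap.trace ℚ _ ((singMap f).hom.onH n) = -1 := by
  -- The realization of `L` followed by `f` is subdivided until it consists of small simplices, to
  -- which the approximation `M.α` applies.
  obtain ⟨s, hs⟩ := M.exists_sdPow f
  let φ : Cx.Hom M.L.cx (SmallSing X M.ε).cx :=
    lift IsSmall.face (((sdSing X).pow s).comp (M.mapβ f)) hs
  have hφ : ∀ n x, (smallIncl X M.ε).f n (φ.f n x)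
      = ((sdSing X).pow s).f n ((M.mapβ f).f n x) := fun n x => subMap_res (hs n x)
  have hφH : ∀ n, φ.onH n = (M.smallEquiv n).symm ∘ₗ (singMap f).hom.onH n ∘ₗ M.β.onH n := by
    intro n
    have h1 : (smallIncl X M.ε).onH n ∘ₗ φ.onH n = (M.mapβ f).onH n := by
      rw [← Cx.Hom.onH_comp]
      have : (smallIncl X M.ε).comp φ = ((sdSing X).pow s).comp (M.mapβ f) := by
        rw [Cx.Hom.mk.injEq]
        funext n
        exact LinearMap.ext (hφ n)
      rw [this, Cx.Hom.onH_comp, Cx.Hom.pow_onH (sdSing_onH n), LinearMap.id_comp]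
    rw [← Cx.Hom.onH_comp]
    refine LinearMap.ext fun x => ?_
    rw [LinearMap.comp_apply, LinearEquiv.coe_coe, LinearEquiv.eq_symm_apply]
    exact congr($h1 x)
  have hψ : ∀ n, (M.α.comp φ).onH n = M.toModel n ∘ₗ ((singMap f).hom.onH n ∘ₗ M.β.onH n) := by
    intro n
    rw [Cx.Hom.onH_comp, hφH, toModel, LinearMap.comp_assoc]
  have htr : ∀ n, LinearMap.trace ℚ _ ((singMap f).hom.onH n)
      = LinearMap.trace ℚ _ ((M.α.comp φ).onH n) := by
    intro n
    have := M.finiteDimensional_H n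
    have : FiniteDimensional ℚ (M.L.cx.H n) :=
      Module.Finite.of_surjective _ (M.L.cx.cls_surjective n)
    rw [hψ, LinearMap.trace_comp_comm' ((singMap f).hom.onH n ∘ₗ M.β.onH n) (M.toModel n),
      LinearMap.comp_assoc, β_toModel, LinearMap.comp_id]
  simp only [htr]
  have huniq := M.unique
  refine Cx.sum_trace_onH_eq_neg_one _ K (M.subsingleton_chains hK) ?_ ?_ ?_ fun n => ?_
  · refine finsupp_hom_ext fun v => ?_
    let σ : (Sing X).S 0 := ⟨fun t => isEmptyElim t, continuous_of_const fun t => isEmptyElim t⟩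
    have hσ : IsSmall X M.ε 0 σ := fun t _ => (IsEmpty.false t).elim
    have h1 : ((sdSing X).pow s).f 0 ((M.mapβ f).f 0 (M.L.of v)) = (Sing X).of σ := by
      have h2 : (M.mapβ f).f 0 (M.L.of v) = (Sing X).of σ := by
        refine (congrArg ((singMap f).lin 0) (M.β_zero v σ)).trans ?_
        rw [Map.lin_of, Subsingleton.elim ((singMap f).app 0 σ) σ]
      rw [h2, sdPow_zero]
    have h3 : φ.f 0 (M.L.of v) = (SmallSing X M.ε).of ⟨σ, hσ⟩ := by
      refine (congrArg ((Sing X).res (IsSmall X M.ε) IsSmall.face 0) h1).trans ?_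
      exact res_of σ hσ
    exact (congrArg (M.α.f 0) h3).trans (M.α_zero _ v)
  · simp
  · intro y
    obtain ⟨x⟩ := M.nonempty
    refine ⟨y default • M.L.of x, ?_⟩
    rw [map_smul, bd_of, Fin.sum_univ_one, Subsingleton.elim (M.L.face 0 x) default]
    refine Finsupp.ext fun z => ?_
    simp [Subsingleton.elim z default]
  · have := M.finite (n + 1)
    have := Fintype.ofFinite (M.L.S (n + 1))
    refine (trace_finsupp _).trans (Finset.sum_eq_zero fun v _ => ?_)
    -- the simplices of `φ v` are close to the image under `f` of a point close to `v`
    have h1 : φ.f (n + 1) (M.L.of v) ∈ Finsupp.supported ℚ ℚ {τ | Set.range τ.1 ⊆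
        {y | ∃ x, f x = y ∧ ∀ i, dist x (M.q v i) < η}} := by
      have h := sdPow_mem_chainsIn s (M.mapβ_mem f v)
      exact (Finsupp.mem_supported' _ _).2 fun τ hτ => (Finsupp.mem_supported' _ _).1 h τ.1 hτ
    have h2 : M.α.f (n + 1) (φ.f (n + 1) (M.L.of v)) ∈ Finsupp.supported ℚ ℚ {u | u ≠ v} := by
      refine finsupp_map_mem (M.α.f (n + 1)) (fun τ hτ => ?_) h1
      refine Finsupp.supported_mono ?_ (M.α_mem τ)
      rintro u hu rfl
      obtain ⟨t, ht⟩ := hu 0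
      obtain ⟨x, hx, hxv⟩ := hτ ⟨t, rfl⟩
      rw [← hx] at ht
      have := hf x
      have := dist_triangle_right (f x) x (M.q u 0)
      rw [dist_comm] at ht
      linarith [hxv 0]
    exact Finsupp.notMem_support_iff.1 fun h => h2 h rfl

end FiniteModel

/-! ### Free actions of finite groups and the transfer -/

open Topology

instance (n : ℕ) : ContractibleSpace (Splx (n + 1)) :=
  (convex_stdSimplex ℝ (Fin (n + 1))).contractibleSpace ⟨_, (stdSimplex.vertex 0).2⟩

instance (n : ℕ) : LocallyPathConnectedSpace (Splx n) := by
  refine .of_bases (fun x => Metric.nhds_basis_ball (x := x)) fun x r hr => ?_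
  rw [IsInducing.subtypeVal.isPathConnected_iff]
  have h : Subtype.val '' Metric.ball x r = stdSimplex ℝ (Fin n) ∩ Metric.ball x.1 r := by
    ext y
    constructor
    · rintro ⟨y, hy, rfl⟩
      exact ⟨y.2, hy⟩
    · rintro ⟨hy, hyr⟩
      exact ⟨⟨y, hy⟩, hyr, rfl⟩
  rw [h]
  exact ((convex_stdSimplex ℝ _).inter (convex_ball _ _)).isPathConnected
    ⟨x.1, x.2, Metric.mem_ball_self hr⟩

section Covering

variable {X Y : Type u} [TopologicalSpace X] [TopologicalSpace Y] {G : Type w} [Group G]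
  {Φ : G →* (X ≃ₜ X)} {p : X → Y}

/-- The orbit map of a free action of a finite group on a Hausdorff space is a covering map. -/
lemma isCoveringMap_of_free [T2Space X] [Finite G] (hp : IsQuotientMap p)
    (horb : ∀ x y : X, p x = p y ↔ ∃ g : G, Φ g x = y) (hfree : ∀ g x, Φ g x = x → g = 1) :
    IsCoveringMap p := by
  let : MulAction G X :=
    { smul g x := Φ g x
      one_smul x := by
        change Φ 1 x = x
        rw [map_one]
        rfl
      mul_smul g h x := by
        change Φ (g * h) x = Φ g (Φ h x)
        rw [map_mul]
        rfl }
  have hcov : IsQuotientCoveringMap p G :=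
    { toIsQuotientMap := hp
      continuous_const_smul g := (Φ g).continuous
      apply_eq_iff_mem_orbit {x y} := by
        rw [eq_comm, horb]
        rfl
      disjoint x := by
        have h : ∀ g : G, ∃ U ∈ 𝓝 x, ((g • ·) '' U ∩ U).Nonempty → g = 1 := by
          intro g
          by_cases hg : Φ g x = x
          · exact ⟨Set.univ, Filter.univ_mem, fun _ => hfree g x hg⟩
          · obtain ⟨V, W, hV, hW, hxV, hxW, hVW⟩ := t2_separation hg
            refine ⟨Φ g ⁻¹' V ∩ W, Filter.inter_mem
              ((Φ g).continuous.continuousAt.preimage_mem_nhds (hV.mem_nhds hxV))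
              (hW.mem_nhds hxW), ?_⟩
            rintro ⟨_, ⟨y, hy, rfl⟩, hy'⟩
            exact (Set.disjoint_left.1 hVW hy.1 hy'.2).elim
        choose U hU hUg using h
        refine ⟨⋂ g, U g, Filter.iInter_mem.2 hU, fun g hg => hUg g (hg.mono ?_)⟩
        exact Set.inter_subset_inter (Set.image_mono (Set.iInter_subset _ g))
          (Set.iInter_subset _ g) }
  exact hcov.isCoveringMap

lemma t2Space_of_isCoveringMap [T2Space X] [Finite G] (hp : IsQuotientMap p)
    (horb : ∀ x y : X, p x = p y ↔ ∃ g : G, Φ g x = y) (hcov : IsCoveringMap p) : T2Space Y := by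
  rw [t2Space_iff_of_isOpenQuotientMap ⟨hp.surjective, hp.continuous, hcov.isOpenMap⟩]
  have h : {q : X × X | p q.1 = p q.2} = ⋃ g : G, {q | Φ g q.1 = q.2} := by
    ext q
    simp [horb]
  rw [h]
  exact isClosed_iUnion_of_finite fun g =>
    isClosed_eq ((Φ g).continuous.comp continuous_fst) continuous_snd

lemma locallyEuclidean_of_isCoveringMap {d : ℕ} (hX : LocallyEuclidean d X)
    (hs : Function.Surjective p) (hcov : IsCoveringMap p) : LocallyEuclidean d Y := by
  intro y
  obtain ⟨x, rfl⟩ := hs y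
  obtain ⟨e, he⟩ := hX x
  obtain ⟨e', he', hpe⟩ := hcov.isLocalHomeomorph x
  refine ⟨e'.symm.trans e, ?_⟩
  rw [OpenPartialHomeomorph.trans_source]
  refine ⟨?_, ?_⟩
  · rw [hpe]
    exact e'.map_source he'
  · rw [Set.mem_preimage, hpe, e'.left_inv he']
    exact he

variable {p : C(X, Y)}

lemma exists_lift (hs : Function.Surjective p) (hcov : IsCoveringMap p) {n : ℕ}
    (σ : C(Splx n, Y)) : ∃ τ : C(Splx n, X), p.comp τ = σ := by
  cases n with
  | zero => exact ⟨⟨fun t => isEmptyElim t, continuous_of_const fun t => isEmptyElim t⟩,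
      Subsingleton.elim _ _⟩
  | succ n =>
    obtain ⟨x, hx⟩ := hs (σ (stdSimplex.vertex 0))
    obtain ⟨τ, ⟨-, hτ⟩, -⟩ := hcov.existsUnique_continuousMap_lifts σ _ x hx
    exact ⟨τ, ContinuousMap.ext fun t => congrFun hτ t⟩

/-- Two lifts of a singular simplex differ by an element of the group. -/
lemma exists_comp_eq_of_comp_eq (horb : ∀ x y : X, p x = p y ↔ ∃ g : G, Φ g x = y)
    (hcov : IsCoveringMap p) {n : ℕ} {τ τ' : C(Splx n, X)} (h : p.comp τ = p.comp τ') :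
    ∃ g : G, (Φ g : C(X, X)).comp τ = τ' := by
  cases n with
  | zero => exact ⟨1, Subsingleton.elim _ _⟩
  | succ n =>
    obtain ⟨g, hg⟩ := (horb _ _).1 congr($h (stdSimplex.vertex 0))
    refine ⟨g, ContinuousMap.coe_injective
      (hcov.eq_of_comp_eq (ContinuousMap.continuous _) τ'.continuous ?_ _ hg)⟩
    rw [← ContinuousMap.coe_comp, ← ContinuousMap.coe_comp, ← h]
    congr 1
    ext t
    exact ((horb _ _).2 ⟨g, rfl⟩).symm

end Covering

section Transfer

variable {X Y : Type u} [TopologicalSpace X] [TopologicalSpace Y] {G : Type w} [Group G] [Fintype G]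
  (Φ : G →* (X ≃ₜ X)) {p : C(X, Y)}

/-- The transfer on singular chains, which sends a singular simplex to the sum of its lifts. These
are the translates of a chosen lift. -/
noncomputable def transferLin (hlift : ∀ n (σ : C(Splx n, Y)), ∃ τ : C(Splx n, X), p.comp τ = σ)
    (n : ℕ) : (Sing Y).Chains n →ₗ[ℚ] (Sing X).Chains n :=
  Finsupp.linearCombination ℚ fun σ =>
    ∑ g, (Sing X).of ((Φ g : C(X, X)).comp (hlift n σ).choose)

variable (hlift : ∀ n (σ : C(Splx n, Y)), ∃ τ : C(Splx n, X), p.comp τ = σ)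
  (huniq : ∀ n (τ τ' : C(Splx n, X)), p.comp τ = p.comp τ' → ∃ g : G, (Φ g : C(X, X)).comp τ = τ')

include huniq in
lemma transferLin_of {n : ℕ} (τ : C(Splx n, X)) :
    transferLin Φ hlift n ((Sing Y).of (p.comp τ))
      = ∑ g, (Sing X).of ((Φ g : C(X, X)).comp τ) := by
  rw [transferLin, Finsupp.linearCombination_single, one_smul]
  obtain ⟨h, hh⟩ := huniq n τ _ (hlift n (p.comp τ)).choose_spec.symm
  rw [← hh]
  refine Fintype.sum_equiv (Equiv.mulRight h) _ _ fun g => ?_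
  congr 1
  ext t
  simp

/-- The transfer of a finite covering. -/
noncomputable def transfer : Cx.Hom (Sing Y).cx (Sing X).cx where
  f := transferLin Φ hlift
  comm n c := by
    suffices h : (Sing X).bd n ∘ₗ transferLin Φ hlift (n + 1)
      = transferLin Φ hlift n ∘ₗ (Sing Y).bd n from congr($h c)
    refine finsupp_hom_ext fun σ => ?_
    obtain ⟨τ, rfl⟩ := hlift _ σ
    rw [LinearMap.comp_apply, LinearMap.comp_apply, transferLin_of Φ hlift huniq, bd_of, map_sum,
      map_sum]
    simp only [bd_of, map_smul]
    rw [Finset.sum_comm]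
    refine Finset.sum_congr rfl fun i _ => ?_
    rw [← Finset.smul_sum]
    exact congrArg _ (transferLin_of Φ hlift huniq (τ.comp (faceIncl i))).symm

lemma singMap_transferLin (hp : ∀ g x, p (Φ g x) = p x) (n : ℕ) (c : (Sing Y).Chains n) :
    (singMap p).lin n (transferLin Φ hlift n c) = (Fintype.card G : ℚ) • c := by
  suffices h : (singMap p).lin n ∘ₗ transferLin Φ hlift n
    = (Fintype.card G : ℚ) • LinearMap.id from congr($h c)
  refine finsupp_hom_ext fun σ => ?_
  have h : ∀ g, p.comp ((Φ g : C(X, X)).comp (hlift n σ).choose) = σ := by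
    intro g
    refine Eq.trans ?_ (hlift n σ).choose_spec
    ext t
    simp [hp]
  rw [LinearMap.comp_apply, transferLin, Finsupp.linearCombination_single, one_smul, map_sum]
  simp only [Map.lin_of, singMap_app, h]
  simp [Nat.cast_smul_eq_nsmul]

include huniq in
lemma transferLin_singMap (n : ℕ) (c : (Sing X).Chains n) :
    transferLin Φ hlift n ((singMap p).lin n c)
      = ∑ g, (singMap (Φ g : C(X, X))).lin n c := by
  suffices h : transferLin Φ hlift n ∘ₗ (singMap p).lin n
    = ∑ g, (singMap (Φ g : C(X, X))).lin n by
    rw [← LinearMap.sum_apply, ← h, LinearMap.comp_apply]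
  refine finsupp_hom_ext fun σ => ?_
  rw [LinearMap.comp_apply, Map.lin_of, LinearMap.sum_apply]
  refine (transferLin_of Φ hlift huniq σ).trans (Finset.sum_congr rfl fun g _ => ?_)
  rw [Map.lin_of]
  rfl

include hlift huniq in
/-- The homology of the orbit space of a free action of a finite group is finite-dimensional, and
its dimension is the average of the traces of the elements of the group. -/
lemma card_mul_finrank_H (hp : ∀ g x, p (Φ g x) = p x) (n : ℕ)
    [FiniteDimensional ℚ ((Sing X).cx.H n)] :
    FiniteDimensional ℚ ((Sing Y).cx.H n) ∧
    (Fintype.card G : ℚ) * Module.finrank ℚ ((Sing Y).cx.H n)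
      = ∑ g, LinearMap.trace ℚ _ ((singMap (Φ g : C(X, X))).hom.onH n) := by
  have hG : (Fintype.card G : ℚ) ≠ 0 := Nat.cast_ne_zero.2 Fintype.card_ne_zero
  have h1 : (singMap p).hom.onH n ∘ₗ (transfer Φ hlift huniq).onH n
      = (Fintype.card G : ℚ) • LinearMap.id := by
    refine LinearMap.ext fun x => ?_
    obtain ⟨z, rfl⟩ := Cx.cls_surjective _ n x
    rw [LinearMap.comp_apply, Cx.Hom.onH_cls, Cx.Hom.onH_cls, LinearMap.smul_apply,
      LinearMap.id_apply, ← map_smul]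
    exact congrArg _ (Subtype.ext (singMap_transferLin Φ hlift hp (n + 1) z.1))
  have h2 : (transfer Φ hlift huniq).onH n ∘ₗ (singMap p).hom.onH n
      = ∑ g, (singMap (Φ g : C(X, X))).hom.onH n := by
    refine LinearMap.ext fun x => ?_
    obtain ⟨z, rfl⟩ := Cx.cls_surjective _ n x
    rw [LinearMap.comp_apply, Cx.Hom.onH_cls, Cx.Hom.onH_cls, LinearMap.sum_apply]
    refine Eq.trans ?_ (map_sum ((Sing X).cx.cls n)
      (fun g => (singMap (Φ g : C(X, X))).hom.onKer n z) _)
    refine congrArg _ (Subtype.ext ?_)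
    refine (transferLin_singMap Φ hlift huniq (n + 1) z.1).trans ?_
    rw [AddSubmonoidClass.coe_finsetSum]
    rfl
  have hfin : FiniteDimensional ℚ ((Sing Y).cx.H n) := by
    refine Module.Finite.of_surjective ((singMap p).hom.onH n) fun y => ?_
    refine ⟨(Fintype.card G : ℚ)⁻¹ • (transfer Φ hlift huniq).onH n y, ?_⟩
    rw [map_smul, ← LinearMap.comp_apply, h1, LinearMap.smul_apply, smul_smul,
      inv_mul_cancel₀ hG, one_smul, LinearMap.id_apply]
  refine ⟨hfin, ?_⟩
  rw [← map_sum, ← h2, LinearMap.trace_comp_comm', h1, map_smul, LinearMap.trace_id, smul_eq_mul]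

end Transfer

/-! ### The Euler characteristic in terms of reduced homology -/

open CategoryTheory

lemma finrank_homology {A B C : ModuleCat.{u} ℚ} {f : A ⟶ B} {g : B ⟶ C} (h : f ≫ g = 0)
    {M : Type u} [AddCommGroup M] [Module ℚ M] (c : LinearMap.ker g.hom →ₗ[ℚ] M)
    (hs : Function.Surjective c) (hc : ∀ z, c z = 0 ↔ ∃ y, f.hom y = z.1) :
    Module.finrank ℚ (ShortComplex.mk f g h).homology = Module.finrank ℚ M := by
  have h1 : LinearMap.range (ShortComplex.mk f g h).moduleCatToCycles = LinearMap.ker c := by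
    ext z
    rw [LinearMap.mem_ker, hc]
    constructor
    · rintro ⟨y, rfl⟩
      exact ⟨y, rfl⟩
    · rintro ⟨y, hy⟩
      exact ⟨y, Subtype.ext hy⟩
  refine ((ShortComplex.mk f g h).moduleCatHomologyIso.toLinearEquiv.trans
    ((Submodule.quotEquivOfEq _ _ h1).trans
      (c.quotKerEquivOfSurjective hs))).finrank_eq

section Comparison

variable (X : Type u) [TopologicalSpace X]

/-- The singular chain complex of a space, as a complex in the category of rational vector
spaces. -/
noncomputable abbrev singCx : ChainComplex (ModuleCat.{u} ℚ) ℕ :=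
  ((AlgebraicTopology.singularChainComplexFunctor (ModuleCat.{u} ℚ)).obj
    (ModuleCat.of ℚ (ULift.{u} ℚ))).obj (TopCat.of X)

/-- A singular simplex as an element of the singular chain complex. -/
noncomputable def singGen {n : ℕ} (σ : (Sing X).S (n + 1)) : (singCx X).X n :=
  ((TopCat.toSSet.obj (TopCat.of X)).ιChainComplex (R := ModuleCat.of ℚ (ULift.{u} ℚ))
    ((TopCat.toSSetObjEquiv (TopCat.of X) (.op ⟨n⟩)).symm σ)).hom ⟨1⟩

/-- The comparison of the singular chain complex with the chains of the semisimplicial set of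
singular simplices. -/
noncomputable def toSingCx (n : ℕ) : (Sing X).Chains (n + 1) →ₗ[ℚ] (singCx X).X n :=
  Finsupp.linearCombination ℚ (singGen X)

lemma toSingCx_of {n : ℕ} (σ : (Sing X).S (n + 1)) :
    toSingCx X n ((Sing X).of σ) = singGen X σ := by
  simp [toSingCx]

/-- The inverse of `toSingCx`. -/
noncomputable def ofSingCx (n : ℕ) : (singCx X).X n →ₗ[ℚ] (Sing X).Chains (n + 1) :=
  (Limits.Cofan.IsColimit.desc
    ((TopCat.toSSet.obj (TopCat.of X)).isColimitChainComplexXCofan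
      (ModuleCat.of ℚ (ULift.{u} ℚ)) n) (A := ModuleCat.of ℚ ((Sing X).Chains (n + 1)))
    fun x => ModuleCat.ofHom ((LinearMap.toSpanSingleton ℚ _
      ((Sing X).of (TopCat.toSSetObjEquiv (TopCat.of X) (.op ⟨n⟩) x))).comp
        (ULift.moduleEquiv (R := ℚ) (M := ℚ)).toLinearMap)).hom

lemma ofSingCx_singGen {n : ℕ} (σ : (Sing X).S (n + 1)) :
    ofSingCx X n (singGen X σ) = (Sing X).of σ := by
  have h := Limits.Cofan.IsColimit.fac
    ((TopCat.toSSet.obj (TopCat.of X)).isColimitChainComplexXCofan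
      (ModuleCat.of ℚ (ULift.{u} ℚ)) n) (A := ModuleCat.of ℚ ((Sing X).Chains (n + 1)))
    (fun x => ModuleCat.ofHom ((LinearMap.toSpanSingleton ℚ _
      ((Sing X).of (TopCat.toSSetObjEquiv (TopCat.of X) (.op ⟨n⟩) x))).comp
        (ULift.moduleEquiv (R := ℚ) (M := ℚ)).toLinearMap))
    ((TopCat.toSSetObjEquiv (TopCat.of X) (.op ⟨n⟩)).symm σ)
  refine (congr($(congrArg ModuleCat.Hom.hom h) ⟨1⟩)).trans ?_
  refine (one_smul ℚ _).trans ?_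
  rw [Equiv.apply_symm_apply]

lemma ofSingCx_toSingCx {n : ℕ} (c : (Sing X).Chains (n + 1)) :
    ofSingCx X n (toSingCx X n c) = c := by
  suffices h : ofSingCx X n ∘ₗ toSingCx X n = LinearMap.id from congr($h c)
  refine finsupp_hom_ext fun σ => ?_
  rw [LinearMap.comp_apply, toSingCx_of, ofSingCx_singGen]
  rfl

lemma toSingCx_ofSingCx {n : ℕ} (c : (singCx X).X n) :
    toSingCx X n (ofSingCx X n c) = c := by
  suffices h : ModuleCat.ofHom (toSingCx X n ∘ₗ ofSingCx X n) = 𝟙 ((singCx X).X n) from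
    congr($(congrArg ModuleCat.Hom.hom h) c)
  refine SSet.chainComplex_hom_ext fun x => ?_
  obtain ⟨σ, rfl⟩ := (TopCat.toSSetObjEquiv (TopCat.of X) (.op ⟨n⟩)).symm.surjective x
  refine ModuleCat.hom_ext (LinearMap.ext fun r => ?_)
  obtain ⟨r, rfl⟩ : ∃ q : ℚ, r = q • (⟨1⟩ : ULift ℚ) := ⟨r.down, by ext; simp⟩
  rw [map_smul, map_smul]
  congr 1
  change toSingCx X n (ofSingCx X n (singGen X σ)) = singGen X σ
  rw [ofSingCx_singGen, toSingCx_of]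

/-- The degreewise isomorphism of the singular chain complex with the chains of the semisimplicial
set of singular simplices. -/
noncomputable def singCxEquiv (n : ℕ) : (singCx X).X n ≃ₗ[ℚ] (Sing X).Chains (n + 1) :=
  .ofLinearMap (ofSingCx X n) (toSingCx X n) (LinearMap.ext (ofSingCx_toSingCx X))
    (LinearMap.ext (toSingCx_ofSingCx X))

lemma d_singGen {n : ℕ} (σ : (Sing X).S (n + 2)) :
    ((singCx X).d (n + 1) n).hom (singGen X σ)
      = ∑ i : Fin (n + 2), (-1 : ℚ) ^ (i : ℕ) • singGen X ((Sing X).face i σ) := by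
  have h := (TopCat.toSSet.obj (TopCat.of X)).ιChainComplex_d (ModuleCat.of ℚ (ULift.{u} ℚ))
    ((TopCat.toSSetObjEquiv (TopCat.of X) (.op ⟨n + 1⟩)).symm σ)
  refine (congr($(congrArg ModuleCat.Hom.hom h) ⟨1⟩)).trans ?_
  rw [ModuleCat.hom_sum, LinearMap.sum_apply]
  refine Finset.sum_congr rfl fun i _ => ?_
  rcases Nat.even_or_odd (i : ℕ) with hi | hi
  · rw [hi.neg_one_pow, hi.neg_one_pow, one_smul, one_smul]
    rfl
  · rw [hi.neg_one_pow, hi.neg_one_pow, neg_one_smul, neg_one_smul]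
    rfl

lemma singCxEquiv_d (n : ℕ) (c : (singCx X).X (n + 1)) :
    singCxEquiv X n (((singCx X).d (n + 1) n).hom c)
      = (Sing X).bd (n + 1) (singCxEquiv X (n + 1) c) := by
  obtain ⟨c, rfl⟩ := (singCxEquiv X (n + 1)).symm.surjective c
  rw [LinearEquiv.apply_symm_apply]
  suffices h : (singCxEquiv X n).toLinearMap ∘ₗ ((singCx X).d (n + 1) n).hom ∘ₗ toSingCx X (n + 1)
    = (Sing X).bd (n + 1) from congr($h c)
  refine finsupp_hom_ext fun σ => ?_
  rw [LinearMap.comp_apply, LinearMap.comp_apply, toSingCx_of, d_singGen, map_sum, bd_of]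
  refine Finset.sum_congr rfl fun i _ => ?_
  rw [map_smul]
  exact congrArg _ (ofSingCx_singGen X _)

lemma finrank_homology_succ (n : ℕ) :
    Module.finrank ℚ ((singCx X).homology (n + 1)) = Module.finrank ℚ ((Sing X).cx.H (n + 1)) := by
  have e := ShortComplex.homologyMapIso
    ((singCx X).isoSc' (n + 2) (n + 1) n (by simp) (by simp))
  refine e.toLinearEquiv.finrank_eq.trans ?_
  let e' : LinearMap.ker ((singCx X).d (n + 1) n).hom →ₗ[ℚ] LinearMap.ker ((Sing X).bd (n + 1)) :=
    (singCxEquiv X (n + 1)).toLinearMap.restrict fun z hz => by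
      rw [LinearMap.mem_ker] at hz ⊢
      exact (singCxEquiv_d X n z).symm.trans (by rw [hz, map_zero])
  refine finrank_homology ((singCx X).d_comp_d (n + 2) (n + 1) n)
    ((Sing X).cx.cls (n + 1) ∘ₗ e') ?_ fun z => ?_
  · refine ((Sing X).cx.cls_surjective _).comp fun z => ?_
    refine ⟨⟨(singCxEquiv X (n + 1)).symm z.1, ?_⟩,
      Subtype.ext ((singCxEquiv X (n + 1)).apply_symm_apply z.1)⟩
    rw [LinearMap.mem_ker, ← (singCxEquiv X n).map_eq_zero_iff, singCxEquiv_d,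
      LinearEquiv.apply_symm_apply]
    exact z.2
  · refine (Cx.cls_eq_zero_iff (Sing X).cx _ (e' z)).trans ⟨?_, ?_⟩
    · rintro ⟨y, hy⟩
      refine ⟨(singCxEquiv X (n + 2)).symm y, (singCxEquiv X (n + 1)).injective ?_⟩
      refine (singCxEquiv_d X _ _).trans ?_
      rw [LinearEquiv.apply_symm_apply]
      exact hy
    · rintro ⟨y, hy⟩
      refine ⟨singCxEquiv X (n + 2) y, (singCxEquiv_d X _ y).symm.trans ?_⟩
      exact congrArg _ hy

/-- The unreduced homology of a nonempty space in dimension zero has one dimension more than the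
reduced homology. -/
lemma finrank_homology_zero [Nonempty X] [FiniteDimensional ℚ ((Sing X).cx.H 0)] :
    Module.finrank ℚ ((singCx X).homology 0) = Module.finrank ℚ ((Sing X).cx.H 0) + 1 := by
  have e := ShortComplex.homologyMapIso ((singCx X).isoSc' 1 0 0 (by simp) (by simp))
  refine e.toLinearEquiv.finrank_eq.trans ?_
  obtain ⟨x⟩ := ‹Nonempty X›
  have huniq : Unique ((Sing X).S 0) :=
    ⟨⟨⟨fun t => isEmptyElim t, continuous_of_const fun t => isEmptyElim t⟩⟩,
      fun _ => Subsingleton.elim _ _⟩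
  have h1 : Module.finrank ℚ ((Sing X).Chains 0) = 1 := by simp
  have : FiniteDimensional ℚ ((Sing X).Chains 0) := Module.finite_of_finrank_eq_succ h1
  -- the section of the augmentation given by a point
  let s : (Sing X).Chains 0 →ₗ[ℚ] (Sing X).Chains 1 :=
    Finsupp.linearCombination ℚ fun _ => (Sing X).of (.const _ x)
  have hs : ∀ c, (Sing X).bd 0 (s c) = c := by
    intro c
    suffices h : (Sing X).bd 0 ∘ₗ s = LinearMap.id from congr($h c)
    refine finsupp_hom_ext fun σ => ?_
    rw [LinearMap.comp_apply, Finsupp.linearCombination_single, one_smul, bd_of,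
      Fin.sum_univ_one, LinearMap.id_apply, Subsingleton.elim σ ((Sing X).face 0 (.const _ x))]
    simp
  let r : (Sing X).Chains 1 →ₗ[ℚ] LinearMap.ker ((Sing X).bd 0) :=
    (LinearMap.id - s ∘ₗ (Sing X).bd 0).codRestrict _ fun c => by
      rw [LinearMap.mem_ker, LinearMap.sub_apply, map_sub, LinearMap.comp_apply, hs,
        LinearMap.id_apply, sub_self]
  have hr : ∀ c, (r c : (Sing X).Chains 1) = c - s ((Sing X).bd 0 c) := fun c => rfl
  let e' : LinearMap.ker ((singCx X).d 0 0).hom →ₗ[ℚ] (Sing X).Chains 1 :=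
    (singCxEquiv X 0).toLinearMap ∘ₗ Submodule.subtype _
  have he' : ∀ z, e' z = singCxEquiv X 0 z.1 := fun z => rfl
  refine (finrank_homology ((singCx X).d_comp_d 1 0 0)
    ((((Sing X).cx.cls 0 ∘ₗ r).prod ((Sing X).bd 0)) ∘ₗ e') ?_ fun z => ?_).trans ?_
  · rintro ⟨h, t⟩
    obtain ⟨k, rfl⟩ := (Sing X).cx.cls_surjective 0 h
    have hk : (Sing X).bd 0 k.1 = 0 := k.2
    refine ⟨⟨(singCxEquiv X 0).symm (k.1 + s t), ?_⟩, ?_⟩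
    · rw [LinearMap.mem_ker, (singCx X).shape 0 0 (by simp)]
      rfl
    · rw [LinearMap.comp_apply, he', LinearEquiv.apply_symm_apply, LinearMap.prod_apply]
      refine Prod.ext (congrArg ((Sing X).cx.cls 0) (Subtype.ext ?_)) ?_
      · refine (hr _).trans ?_
        have hks : (Sing X).bd 0 (k.1 + s t) = t := by rw [map_add, hs, hk, zero_add]
        rw [hks]
        exact add_sub_cancel_right _ _
      · change (Sing X).bd 0 (k.1 + s t) = t
        rw [map_add, hs, hk, zero_add]
  · rw [LinearMap.comp_apply, LinearMap.prod_apply, Prod.ext_iff]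
    refine (and_congr_left' (Cx.cls_eq_zero_iff (Sing X).cx 0 (r (e' z)))).trans ⟨?_, ?_⟩
    · rintro ⟨⟨y, hy⟩, hz⟩
      refine ⟨(singCxEquiv X 1).symm y, (singCxEquiv X 0).injective ?_⟩
      refine (singCxEquiv_d X _ _).trans ?_
      rw [LinearEquiv.apply_symm_apply]
      refine hy.trans ?_
      rw [hr, show (Sing X).bd 0 (e' z) = 0 from hz, map_zero, sub_zero]
      rfl
    · rintro ⟨y, hy⟩
      have h2 : (Sing X).bd 1 (singCxEquiv X 1 y) = e' z :=
        (singCxEquiv_d X _ y).symm.trans (congrArg _ hy)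
      have h3 : (Sing X).bd 0 (e' z) = 0 := by rw [← h2, bd_bd]
      refine ⟨⟨singCxEquiv X 1 y, h2.trans ?_⟩, h3⟩
      rw [hr, h3, map_zero, sub_zero]
  · rw [Module.finrank_prod, h1]

lemma eulerCharacteristic_eq_zero_of_isEmpty [IsEmpty X] : eulerCharacteristic X = 0 := by
  refine finsum_eq_zero_of_forall_eq_zero fun n => ?_
  have : IsEmpty ((Sing X).S (n + 1)) := ⟨fun σ => isEmptyElim (σ (stdSimplex.vertex 0))⟩
  have : Subsingleton ((singCx X).X n) := (singCxEquiv X n).injective.subsingleton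
  have h : Limits.IsZero ((singCx X).homology n) :=
    ShortComplex.isZero_homology_of_isZero_X₂ _ (ModuleCat.isZero_of_subsingleton ((singCx X).X n))
  have := ModuleCat.subsingleton_of_isZero h
  rw [Module.finrank_zero_of_subsingleton]
  simp

variable {X}

/-- The Euler characteristic of a nonempty space is one plus the alternating sum of the dimensions
of its reduced homology. -/
lemma eulerCharacteristic_eq [Nonempty X] (hfin : ∀ n, FiniteDimensional ℚ ((Sing X).cx.H n))
    {K : ℕ} (hK0 : 0 < K) (hK : ∀ n, K ≤ n → Subsingleton ((Sing X).cx.H n)) :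
    eulerCharacteristic X
      = 1 + ∑ n ∈ Finset.range K, (-1) ^ n * (Module.finrank ℚ ((Sing X).cx.H n) : ℤ) := by
  have h : ∀ n, Module.finrank ℚ ((singCx X).homology n)
      = Module.finrank ℚ ((Sing X).cx.H n) + if n = 0 then 1 else 0 := by
    intro n
    cases n with
    | zero => exact finrank_homology_zero X
    | succ n => exact finrank_homology_succ X n
  rw [eulerCharacteristic,
    HomologicalComplex.homologyEulerChar_eq_sum_finSet_of_finrankSupport_subset
    _ (Finset.range K)]
  · have h2 : ∀ n ∈ Finset.range K, ((ComplexShape.down ℕ).χ n : ℤ) *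
        (Module.finrank ℚ ((singCx X).homology n) : ℤ)
        = (-1) ^ n * (Module.finrank ℚ ((Sing X).cx.H n) : ℤ) + if n = 0 then 1 else 0 := by
      intro n _
      rw [h]
      rcases eq_or_ne n 0 with rfl | hn
      · simp
      · simp [hn]
    refine (Finset.sum_congr rfl h2).trans ?_
    rw [Finset.sum_add_distrib, add_comm, Finset.sum_ite_eq' , if_pos (Finset.mem_range.2 hK0)]
  · refine (GradedObject.finrankSupport_subset_iff _ _).2 fun n hn => ?_
    have hn' : K ≤ n := by simpa using hn
    have := hK n hn'
    refine (h n).trans ?_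
    rw [Module.finrank_zero_of_subsingleton, if_neg (by omega)]

end Comparison

/-! ### Multiplicativity of the Euler characteristic -/

section Multiplicativity

variable {X : Type u} [TopologicalSpace X] [T2Space X] [CompactSpace X] {d : ℕ}

lemma metrizableSpace_of_locallyEuclidean (hX : LocallyEuclidean d X) :
    TopologicalSpace.MetrizableSpace X := by
  choose e he using hX
  let : ChartedSpace (EuclideanSpace ℝ (Fin d)) X :=
    { atlas := Set.range e
      chartAt := e
      mem_chart_source := he
      chart_mem_atlas x := ⟨x, rfl⟩ }
  have := ChartedSpace.secondCountable_of_sigmaCompact (EuclideanSpace ℝ (Fin d)) X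
  exact TopologicalSpace.metrizableSpace_of_t3_secondCountable X

/-- A map without fixed points moves all points of a compact metric space by at least a positive
distance. -/
lemma exists_le_dist {X : Type*} [MetricSpace X] [CompactSpace X] {f : X → X} (hf : Continuous f)
    (h : ∀ x, f x ≠ x) : ∃ η > 0, ∀ x, 2 * η ≤ dist (f x) x := by
  rcases isEmpty_or_nonempty X with hX | hX
  · exact ⟨1, one_pos, fun x => isEmptyElim x⟩
  · obtain ⟨x, -, hx⟩ := isCompact_univ.exists_isMinOn Set.univ_nonempty
      (f := fun x => dist (f x) x) (by fun_prop)
    refine ⟨dist (f x) x / 2, half_pos (dist_pos.2 (h x)), fun y => ?_⟩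
    rw [mul_div_cancel₀ _ two_ne_zero]
    exact hx (Set.mem_univ y)

/-- The Euler characteristic of a compact locally Euclidean space is the product of that of its
orbit space by a free action of a finite group and the order of the group. -/
theorem eulerCharacteristic_eq_card_mul (hX : LocallyEuclidean d X) {Y : Type u}
    [TopologicalSpace Y] {G : Type w} [Group G] [Finite G] {Φ : G →* (X ≃ₜ X)} {p : X → Y}
    (hp : IsQuotientMap p) (horb : ∀ x y : X, p x = p y ↔ ∃ g : G, Φ g x = y)
    (hfree : ∀ g x, Φ g x = x → g = 1) :
    eulerCharacteristic X = Nat.card G * eulerCharacteristic Y := by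
  have := Fintype.ofFinite G
  rcases isEmpty_or_nonempty X with hemp | hne
  · have : IsEmpty Y := ⟨fun y => (hp.surjective y).elim fun x _ => isEmptyElim x⟩
    rw [eulerCharacteristic_eq_zero_of_isEmpty, eulerCharacteristic_eq_zero_of_isEmpty, mul_zero]
  have : Nonempty Y := hne.map p
  have hcov := isCoveringMap_of_free hp horb hfree
  have := metrizableSpace_of_locallyEuclidean hX
  let := TopologicalSpace.metrizableSpaceMetric X
  -- finite models, each so fine that it resolves the displacement of the points by the given `g`
  have hmodel : ∀ g : G, ∃ k, (∀ n, FiniteDimensional ℚ ((Sing X).cx.H n)) ∧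
      (∀ n, k ≤ n → Subsingleton ((Sing X).cx.H n)) ∧ (g ≠ 1 → ∀ K, k < K →
        ∑ n ∈ Finset.range K, (-1 : ℚ) ^ n *
          LinearMap.trace ℚ _ ((singMap (Φ g : C(X, X))).hom.onH n) = -1) := by
    intro g
    by_cases hg : g = 1
    · obtain ⟨M⟩ := exists_finiteModel hX one_pos
      exact ⟨M.k, M.finiteDimensional_H, fun n hn => M.subsingleton_H hn,
        fun h => absurd hg h⟩
    · obtain ⟨η, hη, hη'⟩ := exists_le_dist (Φ g).continuous fun x hx => hg (hfree g x hx)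
      obtain ⟨M⟩ := exists_finiteModel hX hη
      exact ⟨M.k, M.finiteDimensional_H, fun n hn => M.subsingleton_H hn,
        fun _ K hK => M.sum_trace_eq_neg_one (Φ g : C(X, X)) hη' hK⟩
  choose k hfin hsub htr using hmodel
  have hfinX := hfin 1
  obtain ⟨K, hK⟩ : ∃ K, ∀ g, k g < K :=
    ⟨Finset.univ.sup k + 1, fun g => Nat.lt_succ_of_le (Finset.le_sup (Finset.mem_univ g))⟩
  have hsubX : ∀ n, K ≤ n → Subsingleton ((Sing X).cx.H n) :=
    fun n hn => hsub 1 n ((hK 1).le.trans hn)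
  have hK0 : 0 < K := (Nat.zero_le _).trans_lt (hK 1)
  have hY : ∀ n, FiniteDimensional ℚ ((Sing Y).cx.H n) ∧
      (Fintype.card G : ℚ) * Module.finrank ℚ ((Sing Y).cx.H n)
        = ∑ g, LinearMap.trace ℚ _ ((singMap (Φ g : C(X, X))).hom.onH n) := by
    intro n
    exact card_mul_finrank_H (p := ⟨p, hp.continuous⟩) Φ
      (fun _ σ => exists_lift hp.surjective hcov σ)
      (fun _ _ _ h => exists_comp_eq_of_comp_eq horb hcov h)
      (fun g x => ((horb _ _).2 ⟨g, rfl⟩).symm) n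
  have hfinY := fun n => (hY n).1
  have hG : (Fintype.card G : ℚ) ≠ 0 := Nat.cast_ne_zero.2 Fintype.card_ne_zero
  have hsubY : ∀ n, K ≤ n → Subsingleton ((Sing Y).cx.H n) := by
    intro n hn
    have := hsubX n hn
    have h := (hY n).2
    have h0 : ∀ g, LinearMap.trace ℚ _ ((singMap (Φ g : C(X, X))).hom.onH n) = 0 := fun g => by
      rw [Subsingleton.elim ((singMap (Φ g : C(X, X))).hom.onH n) 0, map_zero]
    rw [Finset.sum_congr rfl fun g _ => h0 g, Finset.sum_const_zero, mul_eq_zero,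
      or_iff_right hG, Nat.cast_eq_zero] at h
    exact Module.finrank_zero_iff.1 h
  have hone : ∑ n ∈ Finset.range K, (-1 : ℚ) ^ n *
      LinearMap.trace ℚ _ ((singMap (Φ 1 : C(X, X))).hom.onH n)
      = ∑ n ∈ Finset.range K, (-1) ^ n * (Module.finrank ℚ ((Sing X).cx.H n) : ℚ) := by
    refine Finset.sum_congr rfl fun n _ => ?_
    have h1 : (singMap (Φ 1 : C(X, X))).hom.onH n = LinearMap.id := by
      rw [← Cx.Hom.onH_id]
      congr 1
      rw [Cx.Hom.mk.injEq]
      funext m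
      refine finsupp_hom_ext fun σ => ?_
      rw [Map.hom_f, Map.lin_of, map_one]
      rfl
    rw [h1, LinearMap.trace_id]
  have hsum : (Fintype.card G : ℚ) *
      ∑ n ∈ Finset.range K, (-1) ^ n * (Module.finrank ℚ ((Sing Y).cx.H n) : ℚ)
      = ∑ n ∈ Finset.range K, (-1) ^ n * (Module.finrank ℚ ((Sing X).cx.H n) : ℚ)
        - (Fintype.card G - 1) := by
    classical
    have h1 : ∀ n, (Fintype.card G : ℚ) * ((-1) ^ n * (Module.finrank ℚ ((Sing Y).cx.H n) : ℚ))
        = ∑ g, (-1 : ℚ) ^ n * LinearMap.trace ℚ _ ((singMap (Φ g : C(X, X))).hom.onH n) := by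
      intro n
      rw [← Finset.mul_sum, ← (hY n).2]
      ring
    rw [Finset.mul_sum, Finset.sum_congr rfl fun n _ => h1 n, Finset.sum_comm,
      ← Finset.add_sum_erase _ _ (Finset.mem_univ (1 : G)), hone,
      Finset.sum_congr rfl fun g hg => htr g (Finset.ne_of_mem_erase hg) K (hK g),
      Finset.sum_const, Finset.card_erase_of_mem (Finset.mem_univ _), Finset.card_univ,
      nsmul_eq_mul, Nat.cast_pred Fintype.card_pos]
    ring
  rw [eulerCharacteristic_eq hfinX hK0 hsubX, eulerCharacteristic_eq hfinY hK0 hsubY,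
    Nat.card_eq_fintype_card]
  have hfinal : (1 + ∑ n ∈ Finset.range K, (-1) ^ n * (Module.finrank ℚ ((Sing X).cx.H n) : ℚ))
      = Fintype.card G *
        (1 + ∑ n ∈ Finset.range K, (-1) ^ n * (Module.finrank ℚ ((Sing Y).cx.H n) : ℚ)) := by
    linarith
  exact_mod_cast hfinal

end Multiplicativity

/-! ### Iterated actions -/

namespace IteratedAction

/-- Up to equivalence, an iterated action has only nontrivial groups, each of which divides the
Euler characteristic by at least `2`. The homeomorphism `h` absorbs the steps whose groups are
trivial. -/
lemma exists_two_pow_numGroups_le {d : ℕ} : ∀ {X : Type u} [TopologicalSpace X]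
    (A : IteratedAction X), A.FiniteGroups → A.IsFree → T2Space X → CompactSpace X →
    LocallyEuclidean d X → eulerCharacteristic X ≠ 0 →
    ∀ {Z : Type u} [TopologicalSpace Z] (h : Z ≃ₜ X), ∃ B : IteratedAction Z,
      B.FiniteGroups ∧ B.IsFree ∧ 2 ^ B.numGroups ≤ (eulerCharacteristic X).natAbs ∧
      ∃ f : A.lastSpace ≃ₜ B.lastSpace, ∀ z, B.proj z = f (A.proj (h z))
  | X, _, nil, _, _, _, _, _, hχ, Z, _, h =>
    ⟨nil, trivial, trivial, Int.natAbs_pos.2 hχ, h.symm, fun z => (h.symm_apply_apply z).symm⟩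
  | X, _, cons (X₁ := X₁) G Φ p hp horb tail, hA, hA', _, _, hX, hχ, Z, _, h => by
    obtain ⟨hG, hfin⟩ : Finite G ∧ tail.FiniteGroups := hA
    obtain ⟨hfree, hfree'⟩ : (∀ g x, Φ g x = x → g = 1) ∧ tail.IsFree := hA'
    have hcov := isCoveringMap_of_free hp horb hfree
    have hmul := eulerCharacteristic_eq_card_mul hX hp horb hfree
    have hχ₁ : eulerCharacteristic X₁ ≠ 0 := fun h0 => hχ (by rw [hmul, h0, mul_zero])
    have ih := fun {Z : Type u} [TopologicalSpace Z] (h : Z ≃ₜ X₁) =>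
      exists_two_pow_numGroups_le tail hfin hfree' (t2Space_of_isCoveringMap hp horb hcov)
        (hp.surjective.compactSpace hp.continuous)
        (locallyEuclidean_of_isCoveringMap hX hp.surjective hcov) hχ₁ h
    rcases subsingleton_or_nontrivial G with hG1 | hG1
    · have hinj : Function.Injective p := fun x y hxy => by
        obtain ⟨g, rfl⟩ := (horb x y).1 hxy
        rw [Subsingleton.elim g 1, map_one]
        rfl
      have hhom : IsHomeomorph p := ⟨hp.continuous, hcov.isOpenMap, hinj, hp.surjective⟩
      obtain ⟨B, hB, hB', hBn, f, hf⟩ := ih (h.trans hhom.homeomorph)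
      refine ⟨B, hB, hB', ?_, f, hf⟩
      rwa [hmul, Nat.card_unique, Nat.cast_one, one_mul]
    · obtain ⟨B, hB, hB', hBn, f, hf⟩ := ih (Homeomorph.refl X₁)
      let Ψ : G →* (Z ≃ₜ Z) :=
        { toFun g := (h.trans (Φ g)).trans h.symm
          map_one' := by
            ext z
            simp
          map_mul' g g' := by
            ext z
            simp }
      have hΨ : ∀ g z, Ψ g z = h.symm (Φ g (h z)) := fun _ _ => rfl
      refine ⟨cons G Ψ (p ∘ h) (hp.comp h.isQuotientMap) (fun x y => ?_) B, ?_, ?_, ?_, ?_⟩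
      · refine (horb _ _).trans (exists_congr fun g => ?_)
        rw [hΨ, h.symm_apply_eq]
      · exact And.intro hG hB
      · refine And.intro (fun g z hz => hfree g (h z) ?_) hB'
        rw [← h.symm_apply_eq, ← hΨ, hz]
      · rw [hmul, Int.natAbs_mul, Int.natAbs_natCast, numGroups, pow_succ, mul_comm]
        exact Nat.mul_le_mul Finite.one_lt_card hBn
      · change ∃ f : tail.lastSpace ≃ₜ B.lastSpace,
          ∀ z, B.proj (p (h z)) = f (tail.proj (p (h z)))
        exact ⟨f, fun z => hf (p (h z))⟩

end IteratedAction

theorem mainTheorem10 (d : ℕ) (M : Type u) [TopologicalSpace M] [T2Space M] [CompactSpace M]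
    [ChartedSpace (EuclideanSpace ℝ (Fin d)) M] (hχ : eulerCharacteristic M ≠ 0) :
    ∃ l : ℕ, iteratedLength M = l ∧ (l : ℝ) ≤ Real.logb 2 |(eulerCharacteristic M : ℝ)| := by
  have hM : LocallyEuclidean d M := fun x => ⟨chartAt _ x, mem_chart_source _ x⟩
  have hle : iteratedLength M ≤ (Nat.log 2 (eulerCharacteristic M).natAbs : ℕ) := by
    refine iSup_le fun A => iSup_le fun hA => iSup_le fun hA' => Nat.cast_le.2 ?_
    obtain ⟨B, hB, hB', hBn, f, hf⟩ := A.exists_two_pow_numGroups_le hA hA' ‹_› ‹_› hM hχ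
      (Homeomorph.refl M)
    have hlen : A.length ≤ B.numGroups :=
      Nat.sInf_le ⟨B, hB, hB', ⟨f, Homeomorph.refl M, hf⟩, rfl⟩
    exact hlen.trans
      (Nat.le_log_of_pow_le one_lt_two hBn)
  obtain ⟨l, hl⟩ := ENat.ne_top_iff_exists.1 (ne_top_of_le_ne_top (ENat.natCast_ne_top _) hle)
  rw [← hl, Nat.cast_le] at hle
  refine ⟨l, hl.symm, ?_⟩
  rw [← Int.cast_abs, Int.abs_eq_natAbs, Int.cast_natCast]
  exact (Nat.cast_le.2 hle).trans (Real.natLog_le_logb _ _)
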